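/- Let $\gamma\in(0,2)$ and $\lambda\ge 0$ with $\gamma<\lambda^2/3$. Consider the system for $(\Sigma_\varphi,\Omega_{\rm pf})\in\mathbb R^2$ $$\Sigma_\varphi'=-(2-q)\Sigma_\varphi+\sqrt{\tfrac32}\,\lambda\,\Omega_V,\qquad \Omega_{\rm pf}'=[2(1+q)-3\gamma]\,\Omega_{\rm pf},$$ where $\Omega_V=1-\Sigma_\varphi^2-\Omega_{\rm pf}$, $q=-1+3\Sigma_\varphi^2+\tfrac32\gamma\Omega_{\rm pf}$, and $'$ is the derivative with respect to $N\in\mathbb R$. An interior orbit is the image of a solution $N\mapsto(\Sigma_\varphi,\Omega_{\rm pf})(N)$, $N\in\mathbb R$, with $\Omega_V>0$ and $\Omega_{\rm pf}>0$ throughout. An orbit ends at (originates from) a point if its solution converges to that point as $N\to+\infty$ (as $N\to-\infty$). A set of interior orbits is called a 1-parameter set if there is a continuous curve $c:\mathbb R\to\mathbb R^2$ all of whose points lie on orbits of the set and which meets each orbit of the set for exactly one parameter value. In the coordinates $(\Sigma_\varphi,\Omega_{\rm pf})$ put $$\mathrm K_\pm=(\pm1,0),\quad \mathrm{FL}=(0,1),\quad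 \mathrm P=\Big(\tfrac{\lambda}{\sqrt6},0\Big),\quad \mathrm S=\Big(\sqrt{\tfrac32}\,\tfrac{\gamma}{\lambda},\,1-\tfrac{3\gamma}{\lambda^2}\Big).$$ Then through every point with $\Omega_V>0$, $\Omega_{\rm pf}>0$ passes exactly one interior orbit, and: (i) All interior orbits end at $\mathrm S$. (ii) Exactly one interior orbit originates from $\mathrm{FL}$. (iii) The interior orbits that originate from $\mathrm K_-$ form a 1-parameter set. (iv) If $\lambda<\sqrt6$, the interior orbits that originate from $\mathrm K_+$ also form a 1-parameter set, and exactly one interior orbit originates from $\mathrm P$. (v) If $\lambda\ge\sqrt6$, all interior orbits other than the stationary orbit $\{\mathrm S\}$ and the single one from $\mathrm{FL}$ originate from $\mathrm K_-$. -/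

import Mathlib

open Filter Topology

namespace ScalarFluid

/-! A state is a pair `x = (Σ_φ, Ω_pf)`; the parameters are `γ` and `lam` (for `λ`). -/

/-- `Ω_V = 1 - Σ_φ² - Ω_pf`. -/
def OmegaV (x : ℝ × ℝ) : ℝ := 1 - x.1 ^ 2 - x.2

/-- The deceleration parameter `q = -1 + 3 Σ_φ² + (3/2) γ Ω_pf`. -/
noncomputable def decel (γ : ℝ) (x : ℝ × ℝ) : ℝ := -1 + 3 * x.1 ^ 2 + 3 / 2 * γ * x.2

/-- The right-hand side of the dynamical system for `(Σ_φ, Ω_pf)`. -/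
noncomputable def field (γ lam : ℝ) (x : ℝ × ℝ) : ℝ × ℝ :=
  (-(2 - decel γ x) * x.1 + √(3 / 2) * lam * OmegaV x,
    (2 * (1 + decel γ x) - 3 * γ) * x.2)

/-- The interior of the state space: `Ω_V > 0` and `Ω_pf > 0`. -/
def interiorStates : Set (ℝ × ℝ) := {x | 0 < OmegaV x ∧ 0 < x.2}

/-- `x` solves the system for all e-fold times `N`. -/
def IsSolution (γ lam : ℝ) (x : ℝ → ℝ × ℝ) : Prop :=
  ∀ N : ℝ, HasDerivAt x (field γ lam (x N)) N

/-- An interior orbit: the image of a solution that lies in the interior state space. -/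
def IsInteriorOrbit (γ lam : ℝ) (O : Set (ℝ × ℝ)) : Prop :=
  ∃ x : ℝ → ℝ × ℝ, IsSolution γ lam x ∧ Set.range x = O ∧ O ⊆ interiorStates

/-- The orbit `O` ends at `p`: its solution converges to `p` as `N → +∞`. -/
def EndsAt (γ lam : ℝ) (O : Set (ℝ × ℝ)) (p : ℝ × ℝ) : Prop :=
  ∃ x : ℝ → ℝ × ℝ, IsSolution γ lam x ∧ Set.range x = O ∧ Tendsto x atTop (𝓝 p)

/-- The orbit `O` originates from `p`: its solution converges to `p` as `N → -∞`. -/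
def OriginatesFrom (γ lam : ℝ) (O : Set (ℝ × ℝ)) (p : ℝ × ℝ) : Prop :=
  ∃ x : ℝ → ℝ × ℝ, IsSolution γ lam x ∧ Set.range x = O ∧ Tendsto x atBot (𝓝 p)

/-- The interior orbits that originate from `p`. -/
def interiorOrbitsFrom (γ lam : ℝ) (p : ℝ × ℝ) : Set (Set (ℝ × ℝ)) :=
  {O | IsInteriorOrbit γ lam O ∧ OriginatesFrom γ lam O p}

/-- A set `F` of (pairwise disjoint) orbits is a 1-parameter set: a continuous curve
`s ↦ c s`, `s ∈ ℝ`, runs through the orbits of `F` only and meets each of them for exactly one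
parameter value. -/
def IsOneParameterSet (F : Set (Set (ℝ × ℝ))) : Prop :=
  ∃ c : ℝ → ℝ × ℝ, Continuous c ∧ (∀ s, ∃ O ∈ F, c s ∈ O) ∧ ∀ O ∈ F, ∃! s, c s ∈ O

/-- The kinaton fixed point with `Σ_φ = 1`. -/
def Kplus : ℝ × ℝ := (1, 0)

/-- The kinaton fixed point with `Σ_φ = -1`. -/
def Kminus : ℝ × ℝ := (-1, 0)

/-- The power-law fixed point. -/
noncomputable def P (lam : ℝ) : ℝ × ℝ := (lam / √6, 0)

/-- The Friedmann–Lemaître fixed point. -/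
def FL : ℝ × ℝ := (0, 1)

/-- The scaling fixed point. -/
noncomputable def S (γ lam : ℝ) : ℝ × ℝ := (√(3 / 2) * (γ / lam), 1 - 3 * γ / lam ^ 2)

end ScalarFluid

/-! ### Global flows of bounded Lipschitz vector fields -/

section GlobalFlow

variable {E : Type*} [NormedAddCommGroup E] [NormedSpace ℝ E] {v : E → E} {K : NNReal}

/-! Write x = Σ_φ, y = Ω_pf, V = Ω_V, a = √(3/2) λ and c = 3γ/(2a). Then S = (c, 1 - 3c/a), and γ <
λ²/3 reads 3c < a. Both y and V satisfy equations f' = k f, so the interior is invariant; as it is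
bounded, a cutoff of the field makes its solutions global.

Future: with α = `weight` in (0, 1), the function V^α y^(1-α) / (1 - c x)² has logarithmic
derivative a positive multiple of (x - c)² / (1 - c x). LaSalle's argument gives convergence to S.
Backward in time the same function tends to 0 unless the solution is stationary, so y V → 0 and the
boundary is approached.

Past: x' > 0 where x ≤ 0 and x' < 0 where x ≥ a/3. Solutions that meet these half-planes come from
K₋ and K₊ respectively, and the lines x = 0 and, for a < 3, x = a/3 are sections that yield the
1-parameter sets. In between, log(y/V) has derivative 2a(x - c), so the side of x = c decides the
limit: FL if x ≤ c in the past; P if c ≤ x ≤ a/3 in the past and a < 3; the case x ≥ c in the past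
is impossible for a ≥ 3 unless the solution is stationary. Oscillation about c is excluded by
`eventually_fst_le_or_le_fst`.

Saddles: an orbit from FL or P is a limit of solutions that stay in a strip for longer and longer
times (`exists_confined_in_past`). It is unique by a cone estimate for the difference of two
solutions (`exists_nhds_fst_eq_of_snd_eq`). -/

theorem exists_global_solution [CompleteSpace E] {C : ℝ} (hv : LipschitzWith K v)
    (hC : ∀ p, ‖v p‖ ≤ C) (p : E) :
    ∃ f : ℝ → E, f 0 = p ∧ ∀ t, HasDerivAt f (v (f t)) t := by
  have hC0 : 0 ≤ C := (norm_nonneg _).trans (hC p)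
  have local_solution : ∀ T : ℝ, 0 < T →
      ∃ f : ℝ → E, f 0 = p ∧ ∀ t ∈ Set.Ioo (-T) T, HasDerivAt f (v (f t)) t := by
    intro T hT
    have hpl : IsPicardLindelof (fun _ => v)
        (⟨0, by constructor <;> linarith⟩ : Set.Icc (-T) T) p
        -- Speed at most C keeps a solution within C * T of p up to time T, so this radius leaves T
        -- arbitrary.
        (⟨C * T, by positivity⟩ : NNReal) 0 ⟨C, hC0⟩ K :=
      { lipschitzOnWith := fun t _ => hv.lipschitzOnWith
        continuousOn := fun x _ => continuousOn_const
        norm_le := fun t _ x _ => hC x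
        mul_max_le := by simp; exact le_rfl }
    obtain ⟨f, hf0, hf⟩ := hpl.exists_eq_forall_mem_Icc_hasDerivWithinAt₀
    exact ⟨f, hf0, fun t ht =>
      (hf t (Set.Ioo_subset_Icc_self ht)).hasDerivAt (Icc_mem_nhds ht.1 ht.2)⟩
  have hpos : ∀ t : ℝ, 0 < |t| + 1 := fun t => by positivity
  choose! f hf0 hf using local_solution
  have agree : ∀ S T : ℝ, 0 < S → S ≤ T → Set.EqOn (f S) (f T) (Set.Ioo (-S) S) := by
    intro S T hS hST
    refine ODE_solution_unique_of_mem_Ioo (v := fun _ => v) (s := fun _ => Set.univ) (K := K)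
      (t₀ := 0) (fun t _ => hv.lipschitzOnWith) ⟨by linarith, hS⟩
      (fun t ht => ⟨hf S hS t ht, trivial⟩)
      (fun t ht => ⟨hf T (hS.trans_le hST) t ⟨by linarith [ht.1], by linarith [ht.2]⟩, trivial⟩) ?_
    rw [hf0 S hS, hf0 T (hS.trans_le hST)]
  -- The local solutions agree on common intervals; they are glued by reading at t the one that
  -- lives on (-|t| - 1, |t| + 1).
  refine ⟨fun t => f (|t| + 1) t, by simpa using hf0 1 one_pos, fun t => ?_⟩
  have hmem : t ∈ Set.Ioo (-(|t| + 1)) (|t| + 1) := by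
    constructor <;> linarith [neg_abs_le t, le_abs_self t]
  have hT : 0 < |t| + 2 := by positivity
  have hev : (fun s => f (|s| + 1) s) =ᶠ[𝓝 t] f (|t| + 2) := by
    filter_upwards [Ioo_mem_nhds hmem.1 hmem.2] with s hs
    have hs' : |s| < |t| + 1 := abs_lt.2 hs
    exact agree (|s| + 1) (|t| + 2) (hpos s) (by linarith)
      ⟨by linarith [neg_abs_le s], by linarith [le_abs_self s]⟩
  have hd := hf (|t| + 2) hT t ⟨by linarith [hmem.1], by linarith [hmem.2]⟩
  rw [← hev.eq_of_nhds] at hd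
  exact hd.congr_of_eventuallyEq hev

theorem dist_le_of_global_solutions (hv : LipschitzWith K v) {f g : ℝ → E}
    (hf : ∀ t, HasDerivAt f (v (f t)) t) (hg : ∀ t, HasDerivAt g (v (g t)) t) (t : ℝ) :
    dist (f t) (g t) ≤ dist (f 0) (g 0) * Real.exp (K * |t|) := by
  have forward : ∀ {u : E → E} (_ : LipschitzWith K u) {f g : ℝ → E}
      (_ : ∀ t, HasDerivAt f (u (f t)) t) (_ : ∀ t, HasDerivAt g (u (g t)) t) {t : ℝ} (_ : 0 ≤ t),
      dist (f t) (g t) ≤ dist (f 0) (g 0) * Real.exp (K * t) := by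
    intro u hu f g hf hg t ht
    have := dist_le_of_trajectories_ODE (v := fun _ => u) (a := 0) (b := t) (fun _ => hu)
      (fun s _ => (hf s).continuousAt.continuousWithinAt) (fun s _ => (hf s).hasDerivWithinAt)
      (fun s _ => (hg s).continuousAt.continuousWithinAt) (fun s _ => (hg s).hasDerivWithinAt)
      le_rfl t ⟨ht, le_rfl⟩
    simpa using this
  rcases le_total 0 t with ht | ht
  · rw [abs_of_nonneg ht]
    exact forward hv hf hg ht
  · have hu : LipschitzWith K fun p => -v p := hv.neg
    have hrev : ∀ {f : ℝ → E}, (∀ t, HasDerivAt f (v (f t)) t) →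
        ∀ t, HasDerivAt (fun t => f (-t)) (-v (f (-t))) t := by
      intro f hf t
      simpa [Function.comp_def] using (hf (-t)).scomp t (hasDerivAt_neg t)
    have := forward hu (hrev hf) (hrev hg) (neg_nonneg.2 ht)
    rw [abs_of_nonpos ht]
    simpa using this

end GlobalFlow

/-- The integrating factor exp(-∫ k) turns f into a constant, so its sign persists in both time
directions. -/
theorem pos_of_hasDerivAt_mul_self {k f : ℝ → ℝ} (hk : Continuous k)
    (hf : ∀ t, HasDerivAt f (k t * f t) t) {t₀ : ℝ} (h0 : 0 < f t₀) (t : ℝ) : 0 < f t := by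
  have hprim : ∀ t, HasDerivAt (fun t => ∫ s in t₀..t, k s) (k t) t := fun t =>
    intervalIntegral.integral_hasDerivAt_right (hk.intervalIntegrable _ _)
      (hk.stronglyMeasurableAtFilter _ _) hk.continuousAt
  have hd : ∀ t, HasDerivAt (fun t => f t * Real.exp (-∫ s in t₀..t, k s)) 0 t := by
    intro t
    refine ((hf t).mul (hprim t).neg.exp).congr_deriv ?_
    simp only [Pi.neg_apply]
    ring
  have hconst := is_const_of_deriv_eq_zero (fun t => (hd t).differentiableAt)
    (fun t => (hd t).deriv) t t₀
  simp only [intervalIntegral.integral_same, neg_zero, Real.exp_zero, mul_one] at hconst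
  rw [← hconst] at h0
  exact pos_of_mul_pos_left h0 (Real.exp_pos _).le

namespace ScalarFluid

/-! ### The system in scalar form -/

/-- Interior solutions in scalar form, with `a = √(3/2) λ`. -/
structure InteriorSolution (γ a : ℝ) (x y : ℝ → ℝ) : Prop where
  deriv_fst : ∀ t, HasDerivAt x
    (-(3 - 3 * x t ^ 2 - 3 / 2 * γ * y t) * x t + a * (1 - x t ^ 2 - y t)) t
  deriv_snd : ∀ t, HasDerivAt y ((6 * x t ^ 2 + 3 * γ * y t - 3 * γ) * y t) t
  pos : ∀ t, 0 < y t
  lt : ∀ t, 0 < 1 - x t ^ 2 - y t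

/-- The right-hand side of the system with `a = √(3/2) λ`. -/
noncomputable def rhs (γ a : ℝ) (p : ℝ × ℝ) : ℝ × ℝ :=
  (-(3 - 3 * p.1 ^ 2 - 3 / 2 * γ * p.2) * p.1 + a * (1 - p.1 ^ 2 - p.2),
    (6 * p.1 ^ 2 + 3 * γ * p.2 - 3 * γ) * p.2)

theorem field_eq_rhs (γ lam : ℝ) : field γ lam = rhs γ (√(3 / 2) * lam) := by
  funext p
  simp only [field, rhs, decel, OmegaV, Prod.mk.injEq]
  constructor <;> ring

theorem contDiff_rhs (γ a : ℝ) : ContDiff ℝ 1 (rhs γ a) := by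
  unfold rhs
  fun_prop

variable {γ a : ℝ} {x y : ℝ → ℝ}

namespace InteriorSolution

theorem hasDerivAt_prod (h : InteriorSolution γ a x y) (t : ℝ) :
    HasDerivAt (fun t => (x t, y t)) (rhs γ a (x t, y t)) t :=
  (h.deriv_fst t).prodMk (h.deriv_snd t)

theorem continuous_fst (h : InteriorSolution γ a x y) : Continuous x :=
  continuous_iff_continuousAt.2 fun t => (h.deriv_fst t).continuousAt

theorem continuous_snd (h : InteriorSolution γ a x y) : Continuous y :=
  continuous_iff_continuousAt.2 fun t => (h.deriv_snd t).continuousAt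

theorem fst_lt_one (h : InteriorSolution γ a x y) (t : ℝ) : x t < 1 := by
  nlinarith [h.lt t, h.pos t]

theorem neg_one_lt_fst (h : InteriorSolution γ a x y) (t : ℝ) : -1 < x t := by
  nlinarith [h.lt t, h.pos t]

theorem snd_lt_one (h : InteriorSolution γ a x y) (t : ℝ) : y t < 1 := by
  nlinarith [h.lt t, sq_nonneg (x t)]

theorem shift (h : InteriorSolution γ a x y) (s : ℝ) :
    InteriorSolution γ a (fun t => x (t + s)) (fun t => y (t + s)) where
  deriv_fst t := (h.deriv_fst (t + s)).comp_add_const t s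
  deriv_snd t := (h.deriv_snd (t + s)).comp_add_const t s
  pos t := h.pos (t + s)
  lt t := h.lt (t + s)

theorem hasDerivAt_potential (h : InteriorSolution γ a x y) (t : ℝ) :
    HasDerivAt (fun t => 1 - x t ^ 2 - y t)
      ((6 * x t ^ 2 + 3 * γ * y t - 2 * a * x t) * (1 - x t ^ 2 - y t)) t := by
  refine ((((h.deriv_fst t).pow 2).const_sub 1).sub (h.deriv_snd t)).congr_deriv ?_
  simp only [Nat.cast_ofNat]
  ring

end InteriorSolution

/-! ### Global interior solutions and continuous dependence -/

/-- A smooth cutoff that equals `1` on the closure of the interior state space. -/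
noncomputable def cutoff : ContDiffBump (0 : ℝ × ℝ) := ⟨1, 2, one_pos, one_lt_two⟩

/-- The right-hand side multiplied by the cutoff; it is bounded and globally Lipschitz. -/
noncomputable def cutoffRhs (γ a : ℝ) (p : ℝ × ℝ) : ℝ × ℝ := cutoff p • rhs γ a p

theorem hasCompactSupport_cutoffRhs (γ a : ℝ) : HasCompactSupport (cutoffRhs γ a) :=
  cutoff.hasCompactSupport.smul_right

theorem contDiff_cutoffRhs (γ a : ℝ) : ContDiff ℝ 1 (cutoffRhs γ a) :=
  (cutoff.contDiff (n := 1)).smul (contDiff_rhs γ a)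

theorem exists_lipschitzWith_cutoffRhs (γ a : ℝ) : ∃ K, LipschitzWith K (cutoffRhs γ a) :=
  (contDiff_cutoffRhs γ a).lipschitzWith_of_hasCompactSupport
    (hasCompactSupport_cutoffRhs γ a) one_ne_zero

/-- The norm on the product is the maximum norm, so the unit ball is a square that contains the
interior. -/
theorem cutoff_eq_one {p q : ℝ} (hq : 0 < q) (hV : 0 < 1 - p ^ 2 - q) : cutoff (p, q) = 1 := by
  apply cutoff.one_of_mem_closedBall
  rw [mem_closedBall_zero_iff, Prod.norm_def, Real.norm_eq_abs, Real.norm_eq_abs]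
  change max |p| |q| ≤ 1
  exact max_le (abs_le.2 ⟨by nlinarith, by nlinarith⟩) (abs_le.2 ⟨by nlinarith, by nlinarith⟩)

theorem InteriorSolution.hasDerivAt_cutoff (h : InteriorSolution γ a x y) (t : ℝ) :
    HasDerivAt (fun t => (x t, y t)) (cutoffRhs γ a (x t, y t)) t := by
  rw [cutoffRhs, cutoff_eq_one (h.pos t) (h.lt t), one_smul]
  exact h.hasDerivAt_prod t

theorem exists_interiorSolution (γ a : ℝ) {x₀ y₀ : ℝ} (hy : 0 < y₀) (hV : 0 < 1 - x₀ ^ 2 - y₀) :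
    ∃ x y, InteriorSolution γ a x y ∧ x 0 = x₀ ∧ y 0 = y₀ := by
  obtain ⟨K, hK⟩ := exists_lipschitzWith_cutoffRhs γ a
  obtain ⟨C, hC⟩ := (hasCompactSupport_cutoffRhs γ a).exists_bound_of_continuous
    (contDiff_cutoffRhs γ a).continuous
  obtain ⟨f, hf0, hf⟩ := exists_global_solution hK hC (x₀, y₀)
  have hfc : Continuous f := continuous_iff_continuousAt.2 fun t => (hf t).continuousAt
  have hχ : Continuous fun t => cutoff (f t) := cutoff.continuous.comp hfc
  have hx : ∀ t, HasDerivAt (fun t => (f t).1) (cutoffRhs γ a (f t)).1 t := fun t =>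
    (hasFDerivAt_fst (𝕜 := ℝ) (p := f t)).comp_hasDerivAt t (hf t)
  have hy' : ∀ t, HasDerivAt (fun t => (f t).2) (cutoffRhs γ a (f t)).2 t := fun t =>
    (hasFDerivAt_snd (𝕜 := ℝ) (p := f t)).comp_hasDerivAt t (hf t)
  -- The cutoff only multiplies the coefficient k in f' = k f, so y and V stay positive along the
  -- modified flow; hence the cutoff equals 1 there and the original system is solved.
  have hypos : ∀ t, 0 < (f t).2 := by
    refine pos_of_hasDerivAt_mul_self (t₀ := 0)
      (k := fun t => cutoff (f t) * (6 * (f t).1 ^ 2 + 3 * γ * (f t).2 - 3 * γ)) (by fun_prop)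
      (fun t => (hy' t).congr_deriv ?_) (by simpa [hf0] using hy)
    simp only [cutoffRhs, rhs, Prod.smul_snd, smul_eq_mul]
    ring
  have hVpos : ∀ t, 0 < 1 - (f t).1 ^ 2 - (f t).2 := by
    refine pos_of_hasDerivAt_mul_self (t₀ := 0)
      (k := fun t => cutoff (f t) * (6 * (f t).1 ^ 2 + 3 * γ * (f t).2 - 2 * a * (f t).1))
      (by fun_prop)
      (fun t => ((((hx t).pow 2).const_sub 1).sub (hy' t)).congr_deriv ?_)
      (by simpa [hf0] using hV)
    simp only [cutoffRhs, rhs, Prod.smul_snd, Prod.smul_fst, smul_eq_mul, Nat.cast_ofNat]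
    ring
  refine ⟨fun t => (f t).1, fun t => (f t).2, ⟨fun t => ?_, fun t => ?_, hypos, hVpos⟩,
    by simp [hf0], by simp [hf0]⟩
  · refine (hx t).congr_deriv ?_
    rw [cutoffRhs, cutoff_eq_one (hypos t) (hVpos t), one_smul, rhs]
  · refine (hy' t).congr_deriv ?_
    rw [cutoffRhs, cutoff_eq_one (hypos t) (hVpos t), one_smul, rhs]

namespace InteriorSolution

theorem eq_of_eq_at {x' y' : ℝ → ℝ} (h : InteriorSolution γ a x y)
    (h' : InteriorSolution γ a x' y') {t₀ : ℝ} (hx : x t₀ = x' t₀) (hy : y t₀ = y' t₀) :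
    x = x' ∧ y = y' := by
  obtain ⟨K, hK⟩ := exists_lipschitzWith_cutoffRhs γ a
  have := ODE_solution_unique_univ (v := fun _ => cutoffRhs γ a) (s := fun _ => Set.univ)
    (t₀ := t₀) (fun _ => hK.lipschitzOnWith) (fun t => ⟨h.hasDerivAt_cutoff t, trivial⟩)
    (fun t => ⟨h'.hasDerivAt_cutoff t, trivial⟩) (by simp [hx, hy])
  simp only [funext_iff, Prod.mk.injEq] at this
  exact ⟨funext fun t => (this t).1, funext fun t => (this t).2⟩

/-- Interior solutions depend continuously on their initial values. -/
theorem tendsto_of_tendsto_zero {ι : Type*} {l : Filter ι} {u v : ι → ℝ → ℝ}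
    (h : InteriorSolution γ a x y) (hu : ∀ i, InteriorSolution γ a (u i) (v i))
    (hx : Tendsto (fun i => u i 0) l (𝓝 (x 0))) (hy : Tendsto (fun i => v i 0) l (𝓝 (y 0)))
    (t : ℝ) :
    Tendsto (fun i => u i t) l (𝓝 (x t)) ∧ Tendsto (fun i => v i t) l (𝓝 (y t)) := by
  obtain ⟨K, hK⟩ := exists_lipschitzWith_cutoffRhs γ a
  have h0 : Tendsto (fun i => dist (u i 0, v i 0) (x 0, y 0) * Real.exp (K * |t|)) l (𝓝 0) := by
    simpa using (tendsto_iff_dist_tendsto_zero.1 (hx.prodMk_nhds hy)).mul_const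
      (Real.exp (K * |t|))
  have hlim : Tendsto (fun i => (u i t, v i t)) l (𝓝 (x t, y t)) :=
    tendsto_iff_dist_tendsto_zero.2 <| squeeze_zero (fun _ => dist_nonneg)
      (fun i => dist_le_of_global_solutions hK (hu i).hasDerivAt_cutoff h.hasDerivAt_cutoff t) h0
  rw [nhds_prod_eq] at hlim
  exact ⟨hlim.fst, hlim.snd⟩

end InteriorSolution

end ScalarFluid

/-! ### One-dimensional comparison lemmas -/

section Comparison

variable {f f' : ℝ → ℝ}

theorem le_of_deriv_neg_at_level (hf : ∀ t, HasDerivAt f (f' t) t) {c s t : ℝ} (hst : s ≤ t)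
    (h0 : f s ≤ c) (hb : ∀ u ∈ Set.Ico s t, f u = c → f' u < 0) : f t ≤ c :=
  image_le_of_deriv_right_lt_deriv_boundary (B := fun _ => c) (B' := fun _ => 0)
    (fun u _ => (hf u).continuousAt.continuousWithinAt) (fun u _ => (hf u).hasDerivWithinAt) h0
    (fun u => hasDerivAt_const u c) hb ⟨hst, le_rfl⟩

theorem ge_of_deriv_pos_at_level (hf : ∀ t, HasDerivAt f (f' t) t) {c s t : ℝ} (hst : s ≤ t)
    (h0 : c ≤ f s) (hb : ∀ u ∈ Set.Ico s t, f u = c → 0 < f' u) : c ≤ f t :=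
  neg_le_neg_iff.1 <| le_of_deriv_neg_at_level (f := fun t => -f t) (f' := fun t => -f' t)
    (fun t => (hf t).neg) hst (neg_le_neg h0)
    fun u hu h => neg_neg_of_pos (hb u hu (neg_injective h))

theorem le_of_deriv_pos_at_level (hf : ∀ t, HasDerivAt f (f' t) t) {c s t : ℝ} (hst : s ≤ t)
    (h0 : f t ≤ c) (hb : ∀ u ∈ Set.Ioc s t, f u = c → 0 < f' u) : f s ≤ c := by
  have hr : ∀ u, HasDerivAt (fun u => f (-u)) (-f' (-u)) u := fun u => by
    simpa [Function.comp_def] using (hf (-u)).scomp u (hasDerivAt_neg u)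
  simpa using le_of_deriv_neg_at_level hr (neg_le_neg hst) (by simpa using h0)
    fun u hu h => neg_neg_of_pos (hb (-u) ⟨by linarith [hu.2], by linarith [hu.1]⟩ h)

theorem mul_sub_le_sub_of_le_deriv (hf : ∀ t, HasDerivAt f (f' t) t) {ε s t : ℝ} (hst : s ≤ t)
    (hb : ∀ u ∈ Set.Icc s t, ε ≤ f' u) : ε * (t - s) ≤ f t - f s := by
  refine (convex_Icc s t).mul_sub_le_image_sub_of_le_deriv
    (fun u _ => (hf u).continuousAt.continuousWithinAt)
    (fun u _ => (hf u).differentiableAt.differentiableWithinAt) (fun u hu => ?_)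
    s ⟨le_rfl, hst⟩ t ⟨hst, le_rfl⟩ hst
  rw [(hf u).deriv]
  exact hb u (interior_subset hu)

theorem not_le_deriv_of_bounded_below (hf : ∀ t, HasDerivAt f (f' t) t) {ε T B : ℝ} (hε : 0 < ε)
    (hB : ∀ t ≤ T, B ≤ f t) (hb : ∀ t ≤ T, ε ≤ f' t) : False := by
  have hBT := hB T le_rfl
  have hs : T - (f T - B + 1) / ε ≤ T := by
    have : 0 ≤ (f T - B + 1) / ε := by apply div_nonneg <;> linarith
    linarith
  have h := mul_sub_le_sub_of_le_deriv hf hs fun u hu => hb u hu.2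
  have hB' := hB _ hs
  rw [sub_sub_cancel, mul_div_cancel₀ _ hε.ne'] at h
  linarith

/-- If `f' ≥ κ f` and `f ≥ 0` on a left half-line, then `f` decays towards `-∞`. -/
theorem tendsto_zero_atBot_of_mul_le_deriv (hf : ∀ t, HasDerivAt f (f' t) t) {κ T : ℝ}
    (hκ : 0 < κ) (h0 : ∀ t ≤ T, 0 ≤ f t) (hb : ∀ t ≤ T, κ * f t ≤ f' t) :
    Tendsto f atBot (𝓝 0) := by
  have hd : ∀ t, HasDerivAt (fun t => f t * Real.exp (-(κ * t)))
      ((f' t - κ * f t) * Real.exp (-(κ * t))) t := by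
    intro t
    refine ((hf t).mul ((hasDerivAt_id t).const_mul κ).neg.exp).congr_deriv ?_
    simp only [Pi.neg_apply, id]
    ring
  have hle : ∀ t ≤ T, f t ≤ f T * Real.exp (-(κ * T)) * Real.exp (κ * t) := by
    intro t ht
    have := mul_sub_le_sub_of_le_deriv hd (ε := 0) ht fun u hu =>
      mul_nonneg (sub_nonneg.2 (hb u hu.2)) (Real.exp_pos _).le
    have h1 : f t * Real.exp (-(κ * t)) ≤ f T * Real.exp (-(κ * T)) := by linarith
    calc f t = f t * Real.exp (-(κ * t)) * Real.exp (κ * t) := by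
          rw [mul_assoc, ← Real.exp_add, neg_add_cancel, Real.exp_zero, mul_one]
      _ ≤ _ := mul_le_mul_of_nonneg_right h1 (Real.exp_pos _).le
  have hlim : Tendsto (fun t => f T * Real.exp (-(κ * T)) * Real.exp (κ * t)) atBot (𝓝 0) := by
    simpa using (Real.tendsto_exp_atBot.comp
      (tendsto_id.const_mul_atBot hκ)).const_mul (f T * Real.exp (-(κ * T)))
  refine tendsto_of_tendsto_of_tendsto_of_le_of_le' tendsto_const_nhds hlim ?_ ?_
  · filter_upwards [eventually_le_atBot T] with t ht using h0 t ht
  · filter_upwards [eventually_le_atBot T] with t ht using hle t ht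

/-- If `0 ≤ f ≤ B` and `f' ≤ -κ f + e` on a left half-line with `e → 0`, then `f → 0`. -/
theorem tendsto_zero_atBot_of_deriv_le (hf : ∀ t, HasDerivAt f (f' t) t) {e : ℝ → ℝ} {κ B T : ℝ}
    (hκ : 0 < κ) (h0 : ∀ t ≤ T, 0 ≤ f t) (hB : ∀ t ≤ T, f t ≤ B)
    (hb : ∀ t ≤ T, f' t ≤ -κ * f t + e t) (he : Tendsto e atBot (𝓝 0)) :
    Tendsto f atBot (𝓝 0) := by
  rw [tendsto_order]
  refine ⟨fun r hr => ?_, fun r hr => ?_⟩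
  · filter_upwards [eventually_le_atBot T] with t ht using hr.trans_le (h0 t ht)
  obtain ⟨T₁, hT₁⟩ := eventually_atBot.1
    ((tendsto_order.1 he).2 (κ * r / 2) (by positivity))
  filter_upwards [eventually_le_atBot T, eventually_le_atBot T₁] with t ht ht₁
  -- Where f ≥ r, it decreases at rate at least κ r / 2. Backward in time it therefore stays above r
  -- and grows without bound, against `hB`.
  by_contra! hrt
  have hneg : ∀ u, HasDerivAt (fun u => -f u) (-f' u) u := fun u => (hf u).neg
  have hder : ∀ u ≤ t, r ≤ f u → κ * r / 2 ≤ -f' u := by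
    intro u hu hru
    have h1 := hb u (hu.trans ht)
    have h2 := hT₁ u (hu.trans ht₁)
    have h3 := mul_le_mul_of_nonneg_left hru hκ.le
    linarith
  have hge : ∀ u ≤ t, r ≤ f u := by
    intro u hu
    have := le_of_deriv_pos_at_level hneg (c := -r) hu (neg_le_neg hrt) fun s hs h => by
      have := hder s hs.2 (by linarith)
      have : 0 < κ * r / 2 := by positivity
      linarith
    linarith
  exact not_le_deriv_of_bounded_below hneg (ε := κ * r / 2) (T := t) (B := -B) (by positivity)
    (fun u hu => neg_le_neg (hB u (hu.trans ht))) fun u hu => hder u hu (hge u hu)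

end Comparison

namespace ScalarFluid

/-! ### The Lyapunov function -/

/-- Admissible parameters, together with the first coordinate `c` of the scaling point. -/
structure Parameters (γ a c : ℝ) : Prop where
  γ_pos : 0 < γ
  γ_lt_two : γ < 2
  a_pos : 0 < a
  two_mul : 2 * a * c = 3 * γ
  three_mul_lt : 3 * c < a

namespace Parameters

variable {γ a c : ℝ}

theorem c_pos (P : Parameters γ a c) : 0 < c := by
  by_contra! h
  nlinarith [P.γ_pos, P.two_mul, P.a_pos]

theorem c_lt_one (P : Parameters γ a c) : c < 1 := by
  nlinarith [P.γ_lt_two, P.two_mul, P.three_mul_lt, P.c_pos]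

theorem c_sq_lt_one (P : Parameters γ a c) : 0 < 1 - c ^ 2 := by
  nlinarith [P.c_lt_one, P.c_pos]

end Parameters

/-- The weight of `Ω_V` in the Lyapunov function. -/
noncomputable def weight (γ a c : ℝ) : ℝ := 3 * (2 - γ) / (1 - c ^ 2) * c / (2 * a)

/-- The Lyapunov function. -/
noncomputable def lyapunov (γ a c p q : ℝ) : ℝ :=
  weight γ a c * Real.log (1 - p ^ 2 - q) + (1 - weight γ a c) * Real.log q
    - 2 * Real.log (1 - c * p)

variable {γ a c : ℝ} {x y : ℝ → ℝ}

theorem Parameters.weight_pos (P : Parameters γ a c) : 0 < weight γ a c := by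
  have h1 := P.c_sq_lt_one
  have h2 := P.c_pos
  have h3 := P.a_pos
  have h4 : 0 < 2 - γ := by linarith [P.γ_lt_two]
  unfold weight
  positivity

theorem Parameters.weight_lt_one (P : Parameters γ a c) : weight γ a c < 1 := by
  have h1 := P.c_sq_lt_one
  have h2 := P.c_pos
  have h3 := P.a_pos
  unfold weight
  rw [div_mul_eq_mul_div, div_div, div_lt_one (by positivity)]
  -- By 2ac = 3γ the claim 3(2 - γ)c < 2a(1 - c²) is equivalent to 3c < a.
  nlinarith [P.two_mul, P.three_mul_lt]

theorem one_sub_mul_pos (P : Parameters γ a c) {p q : ℝ} (hq : 0 < q) (hV : 0 < 1 - p ^ 2 - q) :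
    1 - c ≤ 1 - c * p ∧ 1 - c * p ≤ 1 + c := by
  have h2 := P.c_pos
  have hp : p ≤ 1 := by nlinarith
  have hp' : -1 ≤ p := by nlinarith
  constructor <;> nlinarith

theorem InteriorSolution.hasDerivAt_lyapunov (h : InteriorSolution γ a x y)
    (P : Parameters γ a c) (t : ℝ) :
    HasDerivAt (fun t => lyapunov γ a c (x t) (y t))
      (3 * (2 - γ) / (1 - c ^ 2) * (x t - c) ^ 2 / (1 - c * x t)) t := by
  have hf : 0 < 1 - c * x t := by
    linarith [(one_sub_mul_pos P (h.pos t) (h.lt t)).1, P.c_lt_one]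
  have hV := h.lt t
  have hy := h.pos t
  refine (((((h.hasDerivAt_potential t).log hV.ne').const_mul (weight γ a c)).add
    (((h.deriv_snd t).log hy.ne').const_mul (1 - weight γ a c))).sub
    (((((h.deriv_fst t).const_mul c).const_sub 1).log hf.ne').const_mul 2)).congr_deriv ?_
  rw [mul_div_cancel_right₀ _ hV.ne', mul_div_cancel_right₀ _ hy.ne']
  have hα : 2 * a * weight γ a c = 3 * (2 - γ) / (1 - c ^ 2) * c := by
    unfold weight
    field_simp [P.a_pos.ne']
  have hκ : 3 * (2 - γ) / (1 - c ^ 2) * (1 - c ^ 2) = 3 * (2 - γ) :=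
    div_mul_cancel₀ _ P.c_sq_lt_one.ne'
  have hc := P.two_mul
  generalize weight γ a c = α at *
  generalize 3 * (2 - γ) / (1 - c ^ 2) = κ at *
  rw [eq_div_iff hf.ne', sub_mul, mul_assoc (2 : ℝ) (_ / _), div_mul_cancel₀ _ hf.ne']
  linear_combination (c - x t) * (1 - c * x t) * hα - (x t ^ 2 - c * x t) * hκ
    + ((1 - x t ^ 2 - y t) - α * (1 - c * x t)) * hc

theorem InteriorSolution.lyapunov_deriv_nonneg (h : InteriorSolution γ a x y)
    (P : Parameters γ a c) (t : ℝ) :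
    0 ≤ 3 * (2 - γ) / (1 - c ^ 2) * (x t - c) ^ 2 / (1 - c * x t) := by
  have hf : 0 < 1 - c * x t := by
    linarith [(one_sub_mul_pos P (h.pos t) (h.lt t)).1, P.c_lt_one]
  have h4 : 0 < 2 - γ := by linarith [P.γ_lt_two]
  have := P.c_sq_lt_one
  positivity

theorem InteriorSolution.monotone_lyapunov (h : InteriorSolution γ a x y)
    (P : Parameters γ a c) : Monotone fun t => lyapunov γ a c (x t) (y t) := by
  refine monotone_of_deriv_nonneg (fun t => (h.hasDerivAt_lyapunov P t).differentiableAt)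
    fun t => ?_
  rw [(h.hasDerivAt_lyapunov P t).deriv]
  exact h.lyapunov_deriv_nonneg P t

/-- A solution along which the Lyapunov function is constant is the scaling point. -/
theorem InteriorSolution.eq_scaling_of_lyapunov_const (h : InteriorSolution γ a x y)
    (P : Parameters γ a c) {ℓ : ℝ} (hL : ∀ t, lyapunov γ a c (x t) (y t) = ℓ) (t : ℝ) :
    x t = c ∧ y t = 1 - 3 * c / a := by
  have hx : ∀ t, x t = c := by
    intro t
    have hd := h.hasDerivAt_lyapunov P t
    rw [funext hL] at hd
    have h0 := hd.unique (hasDerivAt_const t ℓ)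
    have hf : 0 < 1 - c * x t := by
      linarith [(one_sub_mul_pos P (h.pos t) (h.lt t)).1, P.c_lt_one]
    have h4 : 0 < 2 - γ := by linarith [P.γ_lt_two]
    have h5 : 0 < 3 * (2 - γ) / (1 - c ^ 2) := div_pos (by positivity) P.c_sq_lt_one
    rw [div_eq_zero_iff, mul_eq_zero, or_iff_left hf.ne', or_iff_right h5.ne', sq_eq_zero_iff,
      sub_eq_zero] at h0
    exact h0
  refine ⟨hx t, ?_⟩
  have hd := h.deriv_fst t
  rw [funext hx] at hd
  have h0 := hd.unique (hasDerivAt_const t c)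
  have ha := P.a_pos
  -- This is the equation x' = 0 on the line x = c.
  have h1 : (1 - c ^ 2) * (a * y t - (a - 3 * c)) = 0 := by
    linear_combination -h0 - y t * c * P.two_mul / 2
  have h2 := (mul_eq_zero.1 h1).resolve_left P.c_sq_lt_one.ne'
  field_simp
  linarith

theorem lyapunov_le (P : Parameters γ a c) {p q : ℝ} (hq : 0 < q) (hV : 0 < 1 - p ^ 2 - q) :
    lyapunov γ a c p q ≤ weight γ a c * Real.log (1 - p ^ 2 - q)
      + (1 - weight γ a c) * Real.log q - 2 * Real.log (1 - c) := by
  have h := Real.log_le_log (by linarith [P.c_lt_one]) (one_sub_mul_pos P hq hV).1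
  unfold lyapunov
  linarith

theorem log_nonpos_of_interior {p q : ℝ} (hq : 0 < q) (hV : 0 < 1 - p ^ 2 - q) :
    Real.log (1 - p ^ 2 - q) ≤ 0 ∧ Real.log q ≤ 0 :=
  ⟨Real.log_nonpos hV.le (by nlinarith), Real.log_nonpos hq.le (by nlinarith)⟩

/-- Both weights are positive and both logarithms nonpositive, so a lower bound on the weighted sum
bounds each logarithm. Superlevel sets thus stay away from the boundary. -/
theorem exists_lower_bound_of_le_lyapunov (P : Parameters γ a c) (ℓ : ℝ) :
    ∃ δ > 0, ∀ p q : ℝ, 0 < q → 0 < 1 - p ^ 2 - q → ℓ ≤ lyapunov γ a c p q →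
      δ ≤ q ∧ δ ≤ 1 - p ^ 2 - q := by
  have h1 := P.weight_pos
  have h2 : 0 < 1 - weight γ a c := by linarith [P.weight_lt_one]
  set m := ℓ + 2 * Real.log (1 - c)
  refine ⟨min (Real.exp (m / (1 - weight γ a c))) (Real.exp (m / weight γ a c)), by positivity,
    fun p q hq hV hL => ?_⟩
  have hle := lyapunov_le P hq hV
  obtain ⟨hlV, hlq⟩ := log_nonpos_of_interior hq hV
  have e1 := mul_nonpos_of_nonneg_of_nonpos h1.le hlV
  have e2 := mul_nonpos_of_nonneg_of_nonpos h2.le hlq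
  constructor
  · refine (min_le_left _ _).trans ((Real.le_log_iff_exp_le hq).1 ?_)
    rw [div_le_iff₀ h2]
    simp only [m]
    linarith
  · refine (min_le_right _ _).trans ((Real.le_log_iff_exp_le hV).1 ?_)
    rw [div_le_iff₀ h1]
    simp only [m]
    linarith

theorem tendsto_lyapunov (P : Parameters γ a c) {ι : Type*} {l : Filter ι} {u v : ι → ℝ}
    {p q : ℝ} (hq : 0 < q) (hV : 0 < 1 - p ^ 2 - q) (hu : Tendsto u l (𝓝 p))
    (hv : Tendsto v l (𝓝 q)) :
    Tendsto (fun i => lyapunov γ a c (u i) (v i)) l (𝓝 (lyapunov γ a c p q)) := by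
  have hf : 1 - c * p ≠ 0 := by linarith [(one_sub_mul_pos P hq hV).1, P.c_lt_one]
  exact ((((((hu.pow 2).const_sub 1).sub hv).log hV.ne').const_mul _).add
    ((hv.log hq.ne').const_mul _)).sub ((((hu.const_mul c).const_sub 1).log hf).const_mul 2)

/-! ### LaSalle's principle, forward and backward in time -/

namespace InteriorSolution

/-- Where the Lyapunov function converges, the solution converges to the scaling point. -/
theorem tendsto_scaling_of_tendsto_lyapunov (h : InteriorSolution γ a x y)
    (P : Parameters γ a c) {l : Filter ℝ} {ℓ : ℝ} (hl : ∀ s, Tendsto (fun t => s + t) l l)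
    (hL : Tendsto (fun t => lyapunov γ a c (x t) (y t)) l (𝓝 ℓ)) :
    Tendsto (fun t => (x t, y t)) l (𝓝 (c, 1 - 3 * c / a)) := by
  obtain ⟨δ, hδ, hbound⟩ := exists_lower_bound_of_le_lyapunov P (ℓ - 1)
  let Q : Set (ℝ × ℝ) := Set.Icc (-1) 1 ×ˢ Set.Icc 0 1 ∩
    ({z | δ ≤ z.2} ∩ {z | δ ≤ 1 - z.1 ^ 2 - z.2})
  have hQ : IsCompact Q := by
    refine (isCompact_Icc.prod isCompact_Icc).inter_right ?_
    exact (isClosed_le continuous_const _root_.continuous_snd).inter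
      (isClosed_le (g := fun z : ℝ × ℝ => 1 - z.1 ^ 2 - z.2) continuous_const (by fun_prop))
  refine hQ.tendsto_nhds_of_unique_mapClusterPt ?_ ?_
  · filter_upwards [(tendsto_order.1 hL).1 (ℓ - 1) (by linarith)] with t ht
    exact ⟨⟨⟨(h.neg_one_lt_fst t).le, (h.fst_lt_one t).le⟩, (h.pos t).le, (h.snd_lt_one t).le⟩,
      hbound _ _ (h.pos t) (h.lt t) ht.le⟩
  rintro ⟨p, q⟩ ⟨-, hq, hV⟩ hcl
  obtain ⟨X, Y, hXY, hX0, hY0⟩ :=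
    exists_interiorSolution γ a (x₀ := p) (y₀ := q) (hδ.trans_le hq) (hδ.trans_le hV)
  have hne : NeBot (𝓝 (p, q) ⊓ map (fun t => (x t, y t)) l) := hcl
  let m : Filter ℝ := l ⊓ comap (fun t => (x t, y t)) (𝓝 (p, q))
  have hm : NeBot m := by
    rw [← Filter.push_pull', map_neBot_iff] at hne
    rwa [show m = comap (fun t => (x t, y t)) (𝓝 (p, q)) ⊓ l from inf_comm _ _]
  have hlim : Tendsto (fun t => (x t, y t)) m (𝓝 (p, q)) :=
    tendsto_comap.mono_left inf_le_right
  rw [nhds_prod_eq] at hlim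
  -- The solution through the cluster point is, at time s, the limit along `m` of the given solution
  -- at time s + t. Since `l` is translation invariant, the Lyapunov function has the value ℓ there.
  have hconst : ∀ s, lyapunov γ a c (X s) (Y s) = ℓ := by
    intro s
    have hdep := hXY.tendsto_of_tendsto_zero (l := m) (u := fun t s => x (s + t))
      (v := fun t s => y (s + t)) (fun t => h.shift t) (by simpa [hX0] using hlim.fst)
      (by simpa [hY0] using hlim.snd) s
    have h1 := tendsto_lyapunov P (hXY.pos s) (hXY.lt s) hdep.1 hdep.2
    exact tendsto_nhds_unique h1 ((hL.comp (hl s)).mono_left inf_le_left)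
  obtain ⟨e1, e2⟩ := hXY.eq_scaling_of_lyapunov_const P hconst 0
  rw [hX0] at e1
  rw [hY0] at e2
  rw [e1, e2]

theorem lyapunov_bounded_above (h : InteriorSolution γ a x y) (P : Parameters γ a c) (t : ℝ) :
    lyapunov γ a c (x t) (y t) ≤ -2 * Real.log (1 - c) := by
  have h2 : 0 < 1 - weight γ a c := by linarith [P.weight_lt_one]
  obtain ⟨hlV, hlq⟩ := log_nonpos_of_interior (h.pos t) (h.lt t)
  linarith [lyapunov_le P (h.pos t) (h.lt t), mul_nonpos_of_nonneg_of_nonpos P.weight_pos.le hlV,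
    mul_nonpos_of_nonneg_of_nonpos h2.le hlq]

/-- Every interior solution converges to the scaling point. -/
theorem tendsto_scaling (h : InteriorSolution γ a x y) (P : Parameters γ a c) :
    Tendsto (fun t => (x t, y t)) atTop (𝓝 (c, 1 - 3 * c / a)) :=
  h.tendsto_scaling_of_tendsto_lyapunov P (fun s => tendsto_atTop_add_const_left _ s tendsto_id)
    (tendsto_atTop_ciSup (h.monotone_lyapunov P)
      ⟨-2 * Real.log (1 - c), by rintro _ ⟨t, rfl⟩; exact h.lyapunov_bounded_above P t⟩)

/-- In the past every non-stationary interior solution approaches the boundary. -/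
theorem tendsto_mul_zero_atBot (h : InteriorSolution γ a x y) (P : Parameters γ a c)
    (hns : ∃ t, (x t, y t) ≠ (c, 1 - 3 * c / a)) :
    Tendsto (fun t => y t * (1 - x t ^ 2 - y t)) atBot (𝓝 0) := by
  have hmono := h.monotone_lyapunov P
  have hbot : Tendsto (fun t => lyapunov γ a c (x t) (y t)) atBot atBot := by
    refine tendsto_atBot_atBot_of_monotone hmono fun B => ?_
    -- Otherwise the solution tends to S in both time directions; the monotone Lyapunov function
    -- then has equal limits at both ends and is constant.
    by_contra! hB
    have hlim := tendsto_atBot_ciInf hmono ⟨B, by rintro _ ⟨t, rfl⟩; exact (hB t).le⟩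
    have hS := h.tendsto_scaling_of_tendsto_lyapunov P
      (fun s => tendsto_atBot_add_const_left _ s tendsto_id) hlim
    have hS' := h.tendsto_scaling P
    obtain ⟨t₀, ht₀⟩ := hns
    have ha := P.a_pos
    have h3 := P.three_mul_lt
    have hc := P.c_pos
    have hyS : 0 < 1 - 3 * c / a := by rw [sub_pos, div_lt_one ha]; exact h3
    have hVS : 0 < 1 - c ^ 2 - (1 - 3 * c / a) := by
      have : a * c < 3 := by linarith [P.two_mul, P.γ_lt_two]
      have e : 1 - c ^ 2 - (1 - 3 * c / a) = c * (3 - a * c) / a := by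
        field_simp
        ring
      rw [e]
      exact div_pos (mul_pos hc (by linarith)) ha
    rw [nhds_prod_eq] at hS hS'
    have htop : Tendsto (fun t => lyapunov γ a c (x t) (y t)) atTop
        (𝓝 (lyapunov γ a c c (1 - 3 * c / a))) :=
      tendsto_lyapunov P hyS hVS hS'.fst hS'.snd
    have hbot : Tendsto (fun t => lyapunov γ a c (x t) (y t)) atBot
        (𝓝 (lyapunov γ a c c (1 - 3 * c / a))) :=
      tendsto_lyapunov P hyS hVS hS.fst hS.snd
    have hconst : ∀ t, lyapunov γ a c (x t) (y t) = lyapunov γ a c c (1 - 3 * c / a) :=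
      fun t => le_antisymm (hmono.ge_of_tendsto htop t) (hmono.le_of_tendsto hbot t)
    obtain ⟨e1, e2⟩ := h.eq_scaling_of_lyapunov_const P hconst t₀
    exact ht₀ (by rw [e1, e2])
  -- Since y and V are at most 1, y V ≤ V^α y^(1-α) = exp L · (1 - c x)².
  have hle : ∀ t, y t * (1 - x t ^ 2 - y t)
      ≤ Real.exp (lyapunov γ a c (x t) (y t) + 2 * Real.log (1 + c)) := by
    intro t
    have hy := h.pos t
    have hV := h.lt t
    have hf : 0 < 1 - c * x t := by
      linarith [(one_sub_mul_pos P hy hV).1, P.c_lt_one]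
    obtain ⟨hlV, hlq⟩ := log_nonpos_of_interior hy hV
    rw [← Real.log_le_iff_le_exp (mul_pos hy hV), Real.log_mul hy.ne' hV.ne']
    have h1 := Real.log_le_log hf (one_sub_mul_pos P hy hV).2
    have h2 := mul_nonpos_of_nonneg_of_nonpos P.weight_pos.le hlq
    have h3 := mul_nonpos_of_nonneg_of_nonpos (sub_nonneg.2 P.weight_lt_one.le) hlV
    unfold lyapunov
    linarith
  refine squeeze_zero (fun t => (mul_pos (h.pos t) (h.lt t)).le) hle ?_
  exact Real.tendsto_exp_atBot.comp (tendsto_atBot_add_const_right _ _ hbot)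

end InteriorSolution

end ScalarFluid

theorem lt_of_deriv_pos_on {f f' : ℝ → ℝ} (hf : ∀ t, HasDerivAt f (f' t) t) {s t : ℝ}
    (hst : s < t) (hb : ∀ u ∈ Set.Icc s t, 0 < f' u) : f s < f t := by
  refine strictMonoOn_of_deriv_pos (convex_Icc s t)
    (fun u _ => (hf u).continuousAt.continuousWithinAt) (fun u hu => ?_)
    ⟨le_rfl, hst.le⟩ ⟨hst.le, le_rfl⟩ hst
  rw [(hf u).deriv]
  exact hb u (interior_subset hu)

namespace ScalarFluid

variable {γ a c : ℝ} {x y : ℝ → ℝ}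

/-! ### Behaviour near the boundary of the state space -/

namespace InteriorSolution

theorem potential_factor_pos (h : InteriorSolution γ a x y) (P : Parameters γ a c) (t : ℝ) :
    0 < a * (1 - c * x t) :=
  mul_pos P.a_pos (by linarith [(one_sub_mul_pos P (h.pos t) (h.lt t)).1, P.c_lt_one])

/-- The equation for `Σ_φ`, relative to the boundary `Ω_V = 0`. -/
theorem hasDerivAt_fst_potential (h : InteriorSolution γ a x y) (P : Parameters γ a c) (t : ℝ) :
    HasDerivAt x (-(3 - 3 / 2 * γ) * (1 - x t ^ 2) * x t
      + (1 - x t ^ 2 - y t) * (a * (1 - c * x t))) t := by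
  refine (h.deriv_fst t).congr_deriv ?_
  linear_combination (1 - x t ^ 2 - y t) * x t / 2 * P.two_mul

/-- The equation for `Σ_φ`, relative to the boundary `Ω_pf = 0`. -/
theorem hasDerivAt_fst_fluid (h : InteriorSolution γ a x y) (P : Parameters γ a c) (t : ℝ) :
    HasDerivAt x ((1 - x t ^ 2) * (a - 3 * x t) - y t * (a * (1 - c * x t))) t := by
  refine (h.deriv_fst t).congr_deriv ?_
  linear_combination -y t * x t / 2 * P.two_mul

theorem one_sub_sq_pos (h : InteriorSolution γ a x y) (t : ℝ) : 0 < 1 - x t ^ 2 := by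
  linarith [h.lt t, h.pos t]

theorem tendsto_snd_zero_of_tendsto_sq (h : InteriorSolution γ a x y) {l : Filter ℝ}
    (hx : Tendsto (fun t => x t ^ 2) l (𝓝 1)) : Tendsto y l (𝓝 0) := by
  have : Tendsto (fun t => 1 - x t ^ 2) l (𝓝 0) := by simpa using hx.const_sub 1
  exact squeeze_zero (fun t => (h.pos t).le) (fun t => by linarith [h.lt t]) this

/-- On x ≤ 0 both terms of x' relative to V = 0 are nonnegative, and the one with V is positive. So
x = 0 is crossed only upward and at most once. -/
theorem fst_neg_of_lt (h : InteriorSolution γ a x y) (P : Parameters γ a c) {s t : ℝ}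
    (ht : x t ≤ 0) (hst : s < t) : x s < 0 := by
  have hder : ∀ u, x u ≤ 0 → 0 < -(3 - 3 / 2 * γ) * (1 - x u ^ 2) * x u
      + (1 - x u ^ 2 - y u) * (a * (1 - c * x u)) := by
    intro u hu
    have h1 : 0 < 3 - 3 / 2 * γ := by linarith [P.γ_lt_two]
    have h2 := mul_pos (h.lt u) (h.potential_factor_pos P u)
    have h3 := mul_nonneg (mul_pos h1 (h.one_sub_sq_pos u)).le (neg_nonneg.2 hu)
    linarith
  have hle : ∀ u ≤ t, x u ≤ 0 := fun u hu =>
    le_of_deriv_pos_at_level (h.hasDerivAt_fst_potential P) hu ht fun s _ hs => hder s hs.le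
  exact (lt_of_deriv_pos_on (h.hasDerivAt_fst_potential P) hst
    fun u hu => hder u (hle u hu.2)).trans_le ht

/-- A solution that reaches `Σ_φ ≤ 0` comes from `K₋`. -/
theorem tendsto_Kminus (h : InteriorSolution γ a x y) (P : Parameters γ a c) {t₀ : ℝ}
    (ht₀ : x t₀ ≤ 0) : Tendsto (fun t => (x t, y t)) atBot (𝓝 Kminus) := by
  have hT : x (t₀ - 1) < 0 := h.fst_neg_of_lt P ht₀ (by linarith)
  set T := t₀ - 1
  have hμ : 0 < 3 - 3 / 2 * γ := by linarith [P.γ_lt_two]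
  have hneg : ∀ t ≤ T, x t ≤ 0 := fun t ht =>
    (h.fst_neg_of_lt P ht₀ (ht.trans_lt (sub_one_lt t₀))).le
  have hder : ∀ u ≤ T, (3 - 3 / 2 * γ) * ((1 - x u ^ 2) * (-x u)) ≤
      -(3 - 3 / 2 * γ) * (1 - x u ^ 2) * x u + (1 - x u ^ 2 - y u) * (a * (1 - c * x u)) := by
    intro u _
    linarith [mul_pos (h.lt u) (h.potential_factor_pos P u)]
  have hle : ∀ t ≤ T, x t ≤ x T := by
    intro t ht
    have := mul_sub_le_sub_of_le_deriv (h.hasDerivAt_fst_potential P) (ε := 0) ht fun u hu =>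
      (mul_nonneg hμ.le (mul_nonneg (h.one_sub_sq_pos u).le
        (neg_nonneg.2 (hneg u hu.2)))).trans (hder u hu.2)
    linarith
  have hlim : Tendsto (fun t => 1 + x t) atBot (𝓝 0) := by
    refine tendsto_zero_atBot_of_mul_le_deriv (κ := (3 - 3 / 2 * γ) * (-x T)) (T := T)
      (fun t => (h.hasDerivAt_fst_potential P t).const_add 1) (mul_pos hμ (neg_pos.2 hT))
      (fun t _ => by linarith [h.neg_one_lt_fst t]) fun t ht => le_trans ?_ (hder t ht)
    rw [mul_assoc]
    refine mul_le_mul_of_nonneg_left ?_ hμ.le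
    nlinarith [h.neg_one_lt_fst t, hneg t ht, hle t ht,
      mul_nonneg (show 0 ≤ 1 + x t by linarith [h.neg_one_lt_fst t])
        (show 0 ≤ x T - x t by linarith [hle t ht]),
      mul_nonneg (show 0 ≤ 1 + x t by linarith [h.neg_one_lt_fst t]) (sq_nonneg (x t))]
  have hx : Tendsto x atBot (𝓝 (-1)) := by simpa using hlim.const_add (-1)
  exact hx.prodMk_nhds (h.tendsto_snd_zero_of_tendsto_sq (by simpa using hx.pow 2))

theorem lt_neg_deriv_fst (h : InteriorSolution γ a x y) (P : Parameters γ a c) (u : ℝ) :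
    (1 - x u ^ 2) * (3 * x u - a)
      < -((1 - x u ^ 2) * (a - 3 * x u) - y u * (a * (1 - c * x u))) := by
  linarith [mul_pos (h.pos u) (h.potential_factor_pos P u)]

/-- On x ≥ a/3 both terms of x' relative to y = 0 are nonpositive, and the one with y is negative.
So x = a/3 is crossed only downward and at most once. -/
theorem third_lt_fst_of_lt (h : InteriorSolution γ a x y) (P : Parameters γ a c) {s t : ℝ}
    (ht : a / 3 ≤ x t) (hst : s < t) : a / 3 < x s := by
  have hneg : ∀ u, HasDerivAt (fun u => -x u) _ u := fun u => (h.hasDerivAt_fst_fluid P u).neg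
  have hder : ∀ u, a / 3 ≤ x u →
      0 < -((1 - x u ^ 2) * (a - 3 * x u) - y u * (a * (1 - c * x u))) := fun u hu =>
    (mul_nonneg (h.one_sub_sq_pos u).le (by linarith)).trans_lt (h.lt_neg_deriv_fst P u)
  have hle : ∀ u ≤ t, a / 3 ≤ x u := fun u hu => neg_le_neg_iff.1 <|
    le_of_deriv_pos_at_level hneg hu (neg_le_neg ht) fun s _ hs =>
      hder s (neg_injective hs).ge
  have := lt_of_deriv_pos_on hneg hst fun u hu => hder u (hle u hu.2)
  linarith

/-- A solution that reaches `Σ_φ ≥ λ/√6` comes from `K₊`. -/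
theorem tendsto_Kplus (h : InteriorSolution γ a x y) (P : Parameters γ a c) {t₀ : ℝ}
    (ht₀ : a / 3 ≤ x t₀) : Tendsto (fun t => (x t, y t)) atBot (𝓝 Kplus) := by
  have hT : a / 3 < x (t₀ - 1) := h.third_lt_fst_of_lt P ht₀ (by linarith)
  set T := t₀ - 1
  have ha := P.a_pos
  have hge : ∀ t ≤ T, a / 3 ≤ x t := fun t ht =>
    (h.third_lt_fst_of_lt P ht₀ (ht.trans_lt (sub_one_lt t₀))).le
  have hneg : ∀ u, HasDerivAt (fun u => 1 - x u) _ u := fun u =>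
    (h.hasDerivAt_fst_fluid P u).const_sub 1
  have hle : ∀ t ≤ T, x T ≤ x t := by
    intro t ht
    have := mul_sub_le_sub_of_le_deriv hneg (ε := 0) ht fun u hu =>
      (mul_nonneg (h.one_sub_sq_pos u).le (by linarith [hge u hu.2])).trans
        (h.lt_neg_deriv_fst P u).le
    linarith
  have hlim : Tendsto (fun t => 1 - x t) atBot (𝓝 0) := by
    refine tendsto_zero_atBot_of_mul_le_deriv (κ := 3 * x T - a) (T := T) hneg (by linarith)
      (fun t _ => by linarith [h.fst_lt_one t])
      fun t ht => le_trans ?_ (h.lt_neg_deriv_fst P t).le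
    have h1 : 0 ≤ 1 - x t := by linarith [h.fst_lt_one t]
    have h2 : 0 ≤ x t := by linarith [hge t ht]
    have h3 : 3 * x T - a ≤ (1 + x t) * (3 * x t - a) := by
      nlinarith [hle t ht, mul_nonneg h2 (show 0 ≤ 3 * x t - a by linarith [hge t ht])]
    calc (3 * x T - a) * (1 - x t) ≤ (1 + x t) * (3 * x t - a) * (1 - x t) :=
          mul_le_mul_of_nonneg_right h3 h1
      _ = _ := by ring
  have hx : Tendsto x atBot (𝓝 1) := by simpa using hlim.const_sub 1
  exact hx.prodMk_nhds (h.tendsto_snd_zero_of_tendsto_sq (by simpa using hx.pow 2))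

/-- The logarithm of the ratio `Ω_pf / Ω_V`. -/
theorem hasDerivAt_log_ratio (h : InteriorSolution γ a x y) (P : Parameters γ a c) (t : ℝ) :
    HasDerivAt (fun t => Real.log (y t) - Real.log (1 - x t ^ 2 - y t))
      (2 * a * (x t - c)) t := by
  refine (((h.deriv_snd t).log (h.pos t).ne').sub
    ((h.hasDerivAt_potential t).log (h.lt t).ne')).congr_deriv ?_
  rw [mul_div_cancel_right₀ _ (h.lt t).ne', mul_div_cancel_right₀ _ (h.pos t).ne']
  linear_combination P.two_mul

theorem log_ratio_le_iff (h : InteriorSolution γ a x y) (s t : ℝ) :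
    Real.log (y s) - Real.log (1 - x s ^ 2 - y s) ≤ Real.log (y t) - Real.log (1 - x t ^ 2 - y t)
      ↔ y s * (1 - x t ^ 2 - y t) ≤ y t * (1 - x s ^ 2 - y s) := by
  rw [← Real.log_le_log_iff (mul_pos (h.pos s) (h.lt t)) (mul_pos (h.pos t) (h.lt s)),
    Real.log_mul (h.pos s).ne' (h.lt t).ne', Real.log_mul (h.pos t).ne' (h.lt s).ne']
  constructor <;> intro h <;> linarith

theorem ratio_ge_of_fst_le (h : InteriorSolution γ a x y) (P : Parameters γ a c) {s t : ℝ}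
    (hst : s ≤ t) (hx : ∀ u ∈ Set.Icc s t, x u ≤ c) :
    y t * (1 - x s ^ 2 - y s) ≤ y s * (1 - x t ^ 2 - y t) := by
  rw [← h.log_ratio_le_iff]
  have := mul_sub_le_sub_of_le_deriv (fun u => (h.hasDerivAt_log_ratio P u).neg) (ε := 0) hst
    fun u hu => by nlinarith [hx u hu, P.a_pos]
  simp only [Pi.neg_apply] at this
  linarith

theorem ratio_le_of_le_fst (h : InteriorSolution γ a x y) (P : Parameters γ a c) {s t : ℝ}
    (hst : s ≤ t) (hx : ∀ u ∈ Set.Icc s t, c ≤ x u) :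
    y s * (1 - x t ^ 2 - y t) ≤ y t * (1 - x s ^ 2 - y s) := by
  rw [← h.log_ratio_le_iff]
  have := mul_sub_le_sub_of_le_deriv (h.hasDerivAt_log_ratio P) (ε := 0) hst
    fun u hu => by nlinarith [hx u hu, P.a_pos]
  linarith

/-- A non-stationary solution with `0 ≤ Σ_φ ≤ c` in the past comes from `FL`. -/
theorem tendsto_FL (h : InteriorSolution γ a x y) (P : Parameters γ a c)
    (hns : ∃ t, (x t, y t) ≠ (c, 1 - 3 * c / a)) {T : ℝ} (h0 : ∀ t ≤ T, 0 ≤ x t)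
    (hc : ∀ t ≤ T, x t ≤ c) : Tendsto (fun t => (x t, y t)) atBot (𝓝 FL) := by
  have hprod := h.tendsto_mul_zero_atBot P hns
  have hV : Tendsto (fun t => 1 - x t ^ 2 - y t) atBot (𝓝 0) := by
    -- Backward in time y/V is at least its value at T, so V² is at most a constant times y V.
    have hsq : Tendsto (fun t => (1 - x t ^ 2 - y t) ^ 2) atBot (𝓝 0) := by
      have h1 : Tendsto (fun t => y t * (1 - x t ^ 2 - y t) * ((1 - x T ^ 2 - y T) / y T)) atBot
        (𝓝 0) := by simpa using hprod.mul_const ((1 - x T ^ 2 - y T) / y T)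
      refine tendsto_of_tendsto_of_tendsto_of_le_of_le' tendsto_const_nhds h1
        (Eventually.of_forall fun t => sq_nonneg _) ?_
      filter_upwards [eventually_le_atBot T] with t ht
      rw [mul_div_assoc', le_div_iff₀ (h.pos T)]
      have := mul_le_mul_of_nonneg_right
        (h.ratio_ge_of_fst_le P ht fun u hu => hc u hu.2) (h.lt t).le
      linarith
    refine ((Real.continuous_sqrt.tendsto 0).comp hsq).congr' ?_ |>.trans (by simp)
    exact Eventually.of_forall fun t => Real.sqrt_sq (h.lt t).le
  have hμ : 0 < 3 - 3 / 2 * γ := by linarith [P.γ_lt_two]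
  have hx : Tendsto x atBot (𝓝 0) := by
    refine tendsto_zero_atBot_of_deriv_le (h.hasDerivAt_fst_potential P)
      (κ := (3 - 3 / 2 * γ) * (1 - c ^ 2)) (e := fun t => a * (1 - x t ^ 2 - y t))
      (mul_pos hμ P.c_sq_lt_one) h0 hc (fun t ht => ?_) (by simpa using hV.const_mul a)
    have e1 : (3 - 3 / 2 * γ) * (1 - c ^ 2) * x t ≤ (3 - 3 / 2 * γ) * (1 - x t ^ 2) * x t := by
      refine mul_le_mul_of_nonneg_right (mul_le_mul_of_nonneg_left ?_ hμ.le) (h0 t ht)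
      nlinarith [hc t ht, h0 t ht]
    have e2 : (1 - x t ^ 2 - y t) * (a * (1 - c * x t)) ≤ (1 - x t ^ 2 - y t) * (a * 1) := by
      refine mul_le_mul_of_nonneg_left (mul_le_mul_of_nonneg_left ?_ P.a_pos.le) (h.lt t).le
      linarith [mul_nonneg P.c_pos.le (h0 t ht)]
    linarith
  have hy : Tendsto y atBot (𝓝 1) := by
    have := ((hx.pow 2).const_sub 1).sub hV
    simpa using this
  exact hx.prodMk_nhds hy

/-- For x ≥ c the ratio y/V increases in time, so in the past y² is at most a constant times y V,
which tends to 0. -/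
theorem tendsto_snd_zero_of_le_fst (h : InteriorSolution γ a x y) (P : Parameters γ a c)
    (hns : ∃ t, (x t, y t) ≠ (c, 1 - 3 * c / a)) {T : ℝ} (hc : ∀ t ≤ T, c ≤ x t) :
    Tendsto y atBot (𝓝 0) := by
  have hprod := h.tendsto_mul_zero_atBot P hns
  have hsq : Tendsto (fun t => y t ^ 2) atBot (𝓝 0) := by
    have h1 : Tendsto (fun t => y t * (1 - x t ^ 2 - y t) * (y T / (1 - x T ^ 2 - y T))) atBot
      (𝓝 0) := by simpa using hprod.mul_const (y T / (1 - x T ^ 2 - y T))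
    refine tendsto_of_tendsto_of_tendsto_of_le_of_le' tendsto_const_nhds h1
      (Eventually.of_forall fun t => sq_nonneg _) ?_
    filter_upwards [eventually_le_atBot T] with t ht
    rw [mul_div_assoc', le_div_iff₀ (h.lt T)]
    have := mul_le_mul_of_nonneg_right
      (h.ratio_le_of_le_fst P ht fun u hu => hc u hu.2) (h.pos t).le
    linarith
  refine ((Real.continuous_sqrt.tendsto 0).comp hsq).congr' ?_ |>.trans (by simp)
  exact Eventually.of_forall fun t => Real.sqrt_sq (h.pos t).le

/-- A non-stationary solution with `c ≤ Σ_φ ≤ λ/√6` in the past comes from `P`. -/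
theorem tendsto_powerLaw (h : InteriorSolution γ a x y) (P : Parameters γ a c) (ha3 : a < 3)
    (hns : ∃ t, (x t, y t) ≠ (c, 1 - 3 * c / a)) {T : ℝ} (hc : ∀ t ≤ T, c ≤ x t)
    (ha : ∀ t ≤ T, x t ≤ a / 3) : Tendsto (fun t => (x t, y t)) atBot (𝓝 (a / 3, 0)) := by
  have hy := h.tendsto_snd_zero_of_le_fst P hns hc
  have ha0 := P.a_pos
  have hz : Tendsto (fun t => a / 3 - x t) atBot (𝓝 0) := by
    refine tendsto_zero_atBot_of_deriv_le (T := T) (B := a / 3)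
      (fun t => (h.hasDerivAt_fst_fluid P t).const_sub (a / 3))
      (κ := 3 * (1 - (a / 3) ^ 2)) (e := fun t => a * y t) (by nlinarith)
      (fun t ht => by linarith [ha t ht]) (fun t ht => by linarith [hc t ht, P.c_pos])
      (fun t ht => ?_) (by simpa using hy.const_mul a)
    have hx0 : 0 ≤ x t := P.c_pos.le.trans (hc t ht)
    have e1 : (1 - (a / 3) ^ 2) * (a - 3 * x t) ≤ (1 - x t ^ 2) * (a - 3 * x t) :=
      mul_le_mul_of_nonneg_right (by nlinarith [ha t ht]) (by linarith [ha t ht])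
    have e2 : y t * (a * (1 - c * x t)) ≤ y t * (a * 1) :=
      mul_le_mul_of_nonneg_left (mul_le_mul_of_nonneg_left
        (by linarith [mul_nonneg P.c_pos.le hx0]) ha0.le) (h.pos t).le
    linarith
  have hx : Tendsto x atBot (𝓝 (a / 3)) := by simpa using hz.const_sub (a / 3)
  exact hx.prodMk_nhds hy

/-- For `a ≥ 3` no non-stationary solution satisfies `Σ_φ ≥ c` in the past. -/
theorem not_le_fst_of_three_le (h : InteriorSolution γ a x y) (P : Parameters γ a c)
    (ha3 : 3 ≤ a) (hns : ∃ t, (x t, y t) ≠ (c, 1 - 3 * c / a)) {T : ℝ}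
    (hc : ∀ t ≤ T, c ≤ x t) : False := by
  have hy := h.tendsto_snd_zero_of_le_fst P hns hc
  have hc0 := P.c_pos
  have hγ := P.γ_pos
  -- If γ y > c V throughout the past, then V → 0 along with y and x → 1. The derivative of log(y/V)
  -- is then bounded below by a positive constant, so y/V → 0 backward, against y/V > c/γ.
  obtain ⟨T₂, hT₂, hratio⟩ : ∃ T₂ ≤ T, γ * y T₂ ≤ c * (1 - x T₂ ^ 2 - y T₂) := by
    by_contra! hcon
    have hV : ∀ t ≤ T, 1 - x t ^ 2 ≤ (γ / c + 1) * y t := by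
      intro t ht
      have : 1 - x t ^ 2 - y t ≤ γ / c * y t := by
        rw [div_mul_eq_mul_div, le_div_iff₀ hc0]
        linarith [hcon t ht]
      linarith
    have hlim : Tendsto (fun t => (γ / c + 1) * y t) atBot (𝓝 0) := by
      simpa using hy.const_mul (γ / c + 1)
    have hmid : 0 < 1 - ((1 + c) / 2) ^ 2 := by nlinarith [P.c_lt_one]
    obtain ⟨T₃, hT₃⟩ := eventually_atBot.1 ((tendsto_order.1 hlim).2 _ hmid)
    refine not_le_deriv_of_bounded_below (h.hasDerivAt_log_ratio P) (ε := a * (1 - c))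
      (T := min T T₃) (B := Real.log c - Real.log γ) (mul_pos P.a_pos (by linarith [P.c_lt_one]))
      (fun t ht => ?_) fun t ht => ?_
    · have h1 := hcon t (ht.trans (min_le_left _ _))
      have h2 := Real.log_le_log (mul_pos hc0 (h.lt t)) h1.le
      rw [Real.log_mul hc0.ne' (h.lt t).ne', Real.log_mul hγ.ne' (h.pos t).ne'] at h2
      linarith
    · have h1 := hV t (ht.trans (min_le_left _ _))
      have h2 := hT₃ t (ht.trans (min_le_right _ _))
      have h3 := hc t (ht.trans (min_le_left _ _))
      have h4 : (1 + c) / 2 ≤ x t := by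
        by_contra! h5
        nlinarith
      nlinarith [P.a_pos]
  have hratio' : ∀ t ≤ T₂, γ * y t ≤ c * (1 - x t ^ 2 - y t) := by
    intro t ht
    have h1 := h.ratio_le_of_le_fst P ht fun u hu => hc u (hu.2.trans hT₂)
    have h2 := mul_le_mul_of_nonneg_left h1 hγ.le
    have h3 := mul_le_mul_of_nonneg_right hratio (h.lt t).le
    refine le_of_mul_le_mul_right ?_ (h.lt T₂)
    linarith
  -- While γ y ≤ c V and x ≥ c, a ≥ 3 gives 6x² + 3γy - 2ax ≤ -6x(1 - x) + 3x(1 - x²) = -3x(1 - x)²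
  -- ≤ 0. So V decreases in time and stays bounded below in the past.
  have hVge : ∀ t ≤ T₂, 1 - x T₂ ^ 2 - y T₂ ≤ 1 - x t ^ 2 - y t := by
    intro t ht
    have := mul_sub_le_sub_of_le_deriv (fun u => (h.hasDerivAt_potential u).neg) (ε := 0) ht
      fun u hu => by
        have hxc := hc u (hu.2.trans hT₂)
        have hx1 := h.fst_lt_one u
        have hr := hratio' u hu.2
        have hyu := h.pos u
        have hVu := h.lt u
        have hfac : 6 * x u ^ 2 + 3 * γ * y u - 2 * a * x u ≤ 0 := by
          have e1 : 6 * x u ≤ 2 * a * x u := by nlinarith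
          have e2 : 0 ≤ x u * (1 - x u) ^ 2 := mul_nonneg (by linarith) (sq_nonneg _)
          have e3 : c * (1 - x u ^ 2) ≤ x u * (1 - x u ^ 2) :=
            mul_le_mul_of_nonneg_right hxc (by linarith)
          have e4 : 0 ≤ c * y u := mul_nonneg hc0.le hyu.le
          nlinarith
        linarith [mul_nonneg (neg_nonneg.2 hfac) hVu.le]
    simp only [Pi.neg_apply] at this
    linarith
  set v := 1 - x T₂ ^ 2 - y T₂
  have hv : 0 < v := h.lt T₂
  obtain ⟨T₃, hT₃⟩ := eventually_atBot.1
    ((tendsto_order.1 (by simpa using hy.const_mul a : Tendsto (fun t => a * y t) atBot (𝓝 0))).2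
      (v ^ 2) (by positivity))
  -- With 1 - x² ≥ v and a - 3x ≥ 3(1 - x) ≥ 3v/2, the first term of x' is at least 3v²/2, while the
  -- loss from y is below v².
  refine not_le_deriv_of_bounded_below (h.hasDerivAt_fst_fluid P) (ε := v ^ 2 / 2)
    (T := min T₂ T₃) (B := c) (by positivity)
    (fun t ht => hc t (ht.trans ((min_le_left _ _).trans hT₂))) fun t ht => ?_
  have h1 := hVge t (ht.trans (min_le_left _ _))
  have h2 := hT₃ t (ht.trans (min_le_right _ _))
  have h3 := hc t (ht.trans ((min_le_left _ _).trans hT₂))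
  have h4 : v ≤ 1 - x t ^ 2 := by linarith [h.pos t]
  have h5 : 3 * v / 2 ≤ a - 3 * x t := by nlinarith [h.fst_lt_one t]
  have e1 : v * (3 * v / 2) ≤ (1 - x t ^ 2) * (a - 3 * x t) := by
    apply mul_le_mul h4 h5 (by positivity) (by linarith)
  have e2 : y t * (a * (1 - c * x t)) ≤ y t * (a * 1) :=
    mul_le_mul_of_nonneg_left (mul_le_mul_of_nonneg_left
      (by nlinarith) P.a_pos.le) (h.pos t).le
  nlinarith

/-- A non-stationary solution with `Σ_φ > 0` throughout does not oscillate about `Σ_φ = c`. -/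
theorem eventually_fst_le_or_le_fst (h : InteriorSolution γ a x y) (P : Parameters γ a c)
    (hns : ∃ t, (x t, y t) ≠ (c, 1 - 3 * c / a)) (hpos : ∀ t, 0 < x t) :
    (∃ T, ∀ t ≤ T, x t ≤ c) ∨ ∃ T, ∀ t ≤ T, c ≤ x t := by
  by_contra! hcon
  obtain ⟨hgt, hlt⟩ := hcon
  have ha := P.a_pos
  have hc0 := P.c_pos
  have hγ := P.γ_pos
  have hc1 := P.c_sq_lt_one
  -- ε bounds (1 - x²)(a - 3x) below for 0 < x ≤ c. W is a time in which speed ε/2 covers the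
  -- distance 2c, and η is so small that y < η at one time forces a y ≤ ε/2 during the preceding
  -- time W.
  set ε := (1 - c ^ 2) * (a - 3 * c) with hεdef
  have hε : 0 < ε := mul_pos hc1 (by linarith [P.three_mul_lt])
  set W := 4 * c / ε
  have hW : 0 < W := by positivity
  set η := ε / (2 * a) * Real.exp (-(3 * γ * W))
  have hη : 0 < η := by positivity
  set v := c * (3 - a * c) / a
  have hac : a * c < 3 := by linarith [P.two_mul, P.γ_lt_two]
  have hv : 0 < v := div_pos (mul_pos hc0 (by linarith)) ha
  obtain ⟨T, hT⟩ := eventually_atBot.1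
    ((tendsto_order.1 (h.tendsto_mul_zero_atBot P hns)).2 (η * v) (by positivity))
  -- Oscillation gives arbitrarily early times at which x = c with x' ≥ 0.
  obtain ⟨τ, hτT, hτc, hτd⟩ : ∃ τ ≤ T, x τ = c ∧
      0 ≤ (1 - x τ ^ 2) * (a - 3 * x τ) - y τ * (a * (1 - c * x τ)) := by
    obtain ⟨t₁, ht₁, hx₁⟩ := hgt T
    obtain ⟨t₀, ht₀, hx₀⟩ := hlt t₁
    by_contra! hno
    have := le_of_deriv_neg_at_level (h.hasDerivAt_fst_fluid P) ht₀ hx₀.le fun u hu hxu =>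
      hno u (hu.2.le.trans ht₁) hxu
    linarith
  -- On x = c, x' ≥ 0 means that y is at most its value at S, so V ≥ v, the value of V at S. As y V
  -- is small, y is small.
  have hyτ : y τ < η := by
    rw [hτc] at hτd
    have e1 : a * y τ ≤ a - 3 * c := by
      refine le_of_mul_le_mul_left ?_ hc1
      nlinarith
    have e2 : v ≤ 1 - c ^ 2 - y τ := by
      rw [div_le_iff₀ ha]
      nlinarith
    have e3 := hT τ hτT
    rw [hτc] at e3
    refine lt_of_mul_lt_mul_right (lt_of_le_of_lt ?_ e3) hv.le
    exact mul_le_mul_of_nonneg_left e2 (h.pos τ).le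
  have hysmall : ∀ t ∈ Set.Icc (τ - W) τ, a * y t ≤ ε / 2 := by
    intro t ht
    have hlog : ∀ u, HasDerivAt (fun u => Real.log (y u))
        (6 * x u ^ 2 + 3 * γ * y u - 3 * γ) u := fun u => by
      have := (h.deriv_snd u).log (h.pos u).ne'
      rwa [mul_div_cancel_right₀ _ (h.pos u).ne'] at this
    have h1 := mul_sub_le_sub_of_le_deriv hlog (ε := -(3 * γ)) ht.2 fun u _ => by
      have := mul_pos hγ (h.pos u)
      nlinarith [sq_nonneg (x u)]
    have h2 : Real.log (y τ) ≤ Real.log η := Real.log_le_log (h.pos τ) hyτ.le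
    have h3 : Real.log η = Real.log (ε / (2 * a)) - 3 * γ * W := by
      rw [Real.log_mul (by positivity) (Real.exp_pos _).ne', Real.log_exp]
      ring
    have h4 : 3 * γ * (τ - t) ≤ 3 * γ * W :=
      mul_le_mul_of_nonneg_left (by linarith [ht.1]) (by positivity)
    have h5 : Real.log (y t) ≤ Real.log (ε / (2 * a)) := by linarith
    have h6 := (Real.log_le_log_iff (h.pos t) (by positivity)).1 h5
    rw [le_div_iff₀ (by positivity)] at h6
    linarith
  have hder : ∀ t ∈ Set.Icc (τ - W) τ, x t ≤ c →
      ε / 2 ≤ (1 - x t ^ 2) * (a - 3 * x t) - y t * (a * (1 - c * x t)) := by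
    intro t ht hxc
    have hx0 := hpos t
    have e1 : ε ≤ (1 - x t ^ 2) * (a - 3 * x t) :=
      mul_le_mul (by nlinarith) (by linarith) (by linarith [P.three_mul_lt])
        (h.one_sub_sq_pos t).le
    have e2 : y t * (a * (1 - c * x t)) ≤ y t * (a * 1) :=
      mul_le_mul_of_nonneg_left (mul_le_mul_of_nonneg_left
        (by nlinarith) ha.le) (h.pos t).le
    linarith [hysmall t ht]
  have hle : ∀ t ∈ Set.Icc (τ - W) τ, x t ≤ c := fun t ht =>
    le_of_deriv_pos_at_level (h.hasDerivAt_fst_fluid P) ht.2 hτc.le fun u hu hxu =>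
      (half_pos hε).trans_le (hder u ⟨ht.1.trans hu.1.le, hu.2⟩ hxu.le)
  -- Backward from τ the solution drops by at least 2c within time W, which makes x negative.
  have hfin := mul_sub_le_sub_of_le_deriv (h.hasDerivAt_fst_fluid P) (ε := ε / 2)
    (sub_le_self τ hW.le) fun u hu => hder u hu (hle u hu)
  have hWε : ε / 2 * (τ - (τ - W)) = 2 * c := by
    rw [sub_sub_cancel]
    simp only [W]
    field_simp
    ring
  linarith [hpos (τ - W)]

/-- For `a ≥ 3` a non-stationary solution with `Σ_φ > 0` throughout comes from `FL`. -/
theorem tendsto_FL_of_three_le (h : InteriorSolution γ a x y) (P : Parameters γ a c)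
    (ha3 : 3 ≤ a) (hns : ∃ t, (x t, y t) ≠ (c, 1 - 3 * c / a)) (hpos : ∀ t, 0 < x t) :
    Tendsto (fun t => (x t, y t)) atBot (𝓝 FL) := by
  rcases h.eventually_fst_le_or_le_fst P hns hpos with ⟨T, hT⟩ | ⟨T, hT⟩
  · exact h.tendsto_FL P hns (fun t _ => (hpos t).le) hT
  · exact (h.not_le_fst_of_three_le P ha3 hns hT).elim

end InteriorSolution

end ScalarFluid

theorem exists_first_zero {f : ℝ → ℝ} (hf : Continuous f) (h0 : 0 < f 0) {t₁ : ℝ} (ht₁ : 0 ≤ t₁)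
    (h1 : f t₁ ≤ 0) : ∃ T, 0 ≤ T ∧ f T = 0 ∧ ∀ t ∈ Set.Icc 0 T, 0 ≤ f t := by
  obtain ⟨T, ⟨hT, hfT⟩, hmin⟩ :=
    (isCompact_Icc.inter_right (isClosed_Iic.preimage hf) :
      IsCompact (Set.Icc 0 t₁ ∩ f ⁻¹' Set.Iic 0)).exists_isLeast ⟨t₁, ⟨ht₁, le_rfl⟩, h1⟩
  have hpos : ∀ t ∈ Set.Ico 0 T, 0 < f t := fun t ht => by
    by_contra! hneg
    exact absurd (hmin ⟨⟨ht.1, ht.2.le.trans hT.2⟩, hneg⟩) (not_le.2 ht.2)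
  have hzero : f T = 0 := by
    obtain ⟨s, hs, hs0⟩ := intermediate_value_Icc' hT.1 hf.continuousOn ⟨hfT, h0.le⟩
    rcases hs.2.lt_or_eq with hlt | rfl
    · exact absurd hs0 (hpos s ⟨hs.1, hlt⟩).ne'
    · exact hs0
  refine ⟨T, hT.1, hzero, fun t ht => ?_⟩
  rcases ht.2.lt_or_eq with hlt | rfl
  · exact (hpos t ⟨ht.1, hlt⟩).le
  · exact hzero.ge

namespace ScalarFluid

variable {γ a c : ℝ}

/-! ### Existence of solutions from the saddle points -/

/-- A limit of solutions confined on longer and longer time intervals is confined in the past. -/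
theorem exists_confined_in_past {l u s : ℝ} (hl : -1 < l) (hu : u < 1) (hs0 : 0 < s) (hs1 : s < 1)
    (hex : ∀ n : ℕ, ∃ x y, InteriorSolution γ a x y ∧ (∀ t ∈ Set.Icc (-(n : ℝ)) 0,
      x t ∈ Set.Icc l u) ∧ y 0 = s * (1 - x 0 ^ 2)) :
    ∃ x y, InteriorSolution γ a x y ∧ (∀ t ≤ 0, x t ∈ Set.Icc l u) ∧ y 0 = s * (1 - x 0 ^ 2) := by
  choose x y hsol hconf hsec using hex
  obtain ⟨p, hp, φ, hφ, hlim⟩ := isCompact_Icc.tendsto_subseq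
    (x := fun n => x n 0) (fun n => hconf n 0 ⟨by simp, le_rfl⟩)
  -- On the section y is a function of x, so a limit of the x-values suffices; the strict bounds on
  -- l, u and s keep the limit point in the interior.
  have hp1 : 0 < 1 - p ^ 2 := by nlinarith [hp.1, hp.2]
  obtain ⟨X, Y, hXY, hX0, hY0⟩ := exists_interiorSolution γ a (x₀ := p) (y₀ := s * (1 - p ^ 2))
    (mul_pos hs0 hp1) (by nlinarith)
  refine ⟨X, Y, hXY, fun t ht => ?_, by rw [hY0, hX0]⟩
  have hlimX : Tendsto (fun n => x (φ n) 0) atTop (𝓝 (X 0)) := by rw [hX0]; exact hlim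
  have hlimY : Tendsto (fun n => y (φ n) 0) atTop (𝓝 (Y 0)) := by
    rw [hY0]
    simp only [hsec]
    exact ((hlim.pow 2).const_sub 1).const_mul s
  refine isClosed_Icc.mem_of_tendsto
    (hXY.tendsto_of_tendsto_zero (fun n => hsol (φ n)) hlimX hlimY t).1 ?_
  obtain ⟨N, hN⟩ := exists_nat_ge (-t)
  filter_upwards [eventually_ge_atTop N] with n hn
  refine hconf (φ n) t ⟨?_, ht⟩
  have : (N : ℝ) ≤ φ n := Nat.cast_le.2 (hn.trans (hφ.id_le n))
  linarith

/-- On this curve V = sigmoid(-w)(1 - x²), so y/V = exp w: the sections are the level curves of the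
log ratio. -/
theorem InteriorSolution.log_ratio_of_section {x y : ℝ → ℝ} (h : InteriorSolution γ a x y)
    {w t : ℝ} (ht : y t = Real.sigmoid w * (1 - x t ^ 2)) :
    Real.log (y t) - Real.log (1 - x t ^ 2 - y t) = w := by
  have hp := h.one_sub_sq_pos t
  have h1 := Real.sigmoid_pos w
  have h2 := Real.sigmoid_pos (-w)
  have hV : 1 - x t ^ 2 - Real.sigmoid w * (1 - x t ^ 2) = Real.sigmoid (-w) * (1 - x t ^ 2) := by
    rw [Real.sigmoid_neg]
    ring
  rw [ht, hV, Real.log_mul h1.ne' hp.ne', Real.log_mul h2.ne' hp.ne',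
    ← Real.sigmoid_mul_rexp_neg, Real.log_mul h1.ne' (Real.exp_pos _).ne', Real.log_exp]
  ring

theorem exists_interiorSolution_of_log_ratio (γ a : ℝ) {p : ℝ} (hp : 0 < 1 - p ^ 2) (w : ℝ) :
    ∃ x y, InteriorSolution γ a x y ∧ x 0 = p ∧ y 0 = Real.sigmoid w * (1 - p ^ 2) ∧
      Real.log (y 0) - Real.log (1 - x 0 ^ 2 - y 0) = w := by
  have h1 := mul_pos (Real.sigmoid_pos w) hp
  have h2 := mul_pos (sub_pos.2 (Real.sigmoid_lt_one w)) hp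
  obtain ⟨x, y, h, hx, hy⟩ := exists_interiorSolution γ a (x₀ := p)
    (y₀ := Real.sigmoid w * (1 - p ^ 2)) h1 (by linarith)
  exact ⟨x, y, h, hx, hy, h.log_ratio_of_section (by rw [hx, hy])⟩

theorem Parameters.exists_sigmoid (P : Parameters γ a c) :
    ∃ w, Real.sigmoid w * (1 - c ^ 2) = 1 - 3 * c / a := by
  have ha := P.a_pos
  have hc := P.c_pos
  have hc1 := P.c_sq_lt_one
  have hac : a * c < 3 := by linarith [P.two_mul, P.γ_lt_two]
  have hmem : (1 - 3 * c / a) / (1 - c ^ 2) ∈ Set.Ioo (0 : ℝ) 1 := by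
    constructor
    · refine div_pos ?_ hc1
      rw [sub_pos, div_lt_one ha]
      exact P.three_mul_lt
    · rw [div_lt_one hc1, sub_lt_sub_iff_left, lt_div_iff₀ ha]
      nlinarith
  rw [← Real.range_sigmoid] at hmem
  obtain ⟨w, hw⟩ := hmem
  exact ⟨w, by rw [hw, div_mul_cancel₀ _ hc1.ne']⟩

/-- On the line x = c the sign of x' depends only on whether the point lies above or below S. -/
theorem InteriorSolution.deriv_fst_at_center {x y : ℝ → ℝ} (P : Parameters γ a c) {t : ℝ}
    (ht : x t = c) :
    (1 - x t ^ 2) * (a - 3 * x t) - y t * (a * (1 - c * x t))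
      = (1 - c ^ 2) * a * (1 - 3 * c / a - y t) := by
  have ha := P.a_pos
  rw [ht]
  field_simp

theorem InteriorSolution.tendsto_section {x y : ℝ → ℝ} (h : InteriorSolution γ a x y)
    (P : Parameters γ a c) (s : ℝ) :
    Tendsto (fun t => y t - s * (1 - x t ^ 2)) atTop
      (𝓝 (1 - 3 * c / a - s * (1 - c ^ 2))) := by
  have hlim := h.tendsto_scaling P
  rw [nhds_prod_eq] at hlim
  exact hlim.snd.sub (((hlim.fst.pow 2).const_sub 1).const_mul s)

/-- Solutions start on x = 0 ever closer to FL and are stopped on a section whose log ratio exceeds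
that of S by 1. Until then 0 ≤ x ≤ c, since x = 0 is crossed only upward and x' < 0 at x = c above
S. The limit is not stationary because S is off the section. -/
theorem exists_tendsto_FL (P : Parameters γ a c) :
    ∃ x y, InteriorSolution γ a x y ∧ Tendsto (fun t => (x t, y t)) atBot (𝓝 FL) := by
  obtain ⟨wS, hwS⟩ := P.exists_sigmoid
  have hc1 := P.c_sq_lt_one
  have hc0 := P.c_pos
  have ha := P.a_pos
  have hγ := P.γ_pos
  have hs : 1 - 3 * c / a < Real.sigmoid (wS + 1) * (1 - c ^ 2) := by
    rw [← hwS]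
    exact mul_lt_mul_of_pos_right (Real.sigmoid_lt (lt_add_one wS)) hc1
  obtain ⟨x, y, h, hconf, hsec⟩ := exists_confined_in_past (γ := γ) (a := a) (l := 0) (u := c)
    (s := Real.sigmoid (wS + 1)) (by norm_num) P.c_lt_one (Real.sigmoid_pos _)
    (Real.sigmoid_lt_one _) fun n => by
      obtain ⟨x, y, h, hx0, hy0, hw0⟩ := exists_interiorSolution_of_log_ratio γ a (p := 0)
        (by norm_num) (wS + 1 + 3 * γ * (n + 1))
      obtain ⟨t₁, ht₁, hneg⟩ := ((eventually_ge_atTop 0).and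
        ((tendsto_order.1 (h.tendsto_section P (Real.sigmoid (wS + 1)))).2 0
          (by linarith))).exists
      obtain ⟨T, hT0, hTsec, hTpos⟩ := exists_first_zero
        (f := fun t => y t - Real.sigmoid (wS + 1) * (1 - x t ^ 2))
        (h.continuous_snd.sub (continuous_const.mul (continuous_const.sub
          (h.continuous_fst.pow 2)))) (by
            have : Real.sigmoid (wS + 1) < Real.sigmoid (wS + 1 + 3 * γ * (n + 1)) :=
              Real.sigmoid_lt (by linarith [show 0 < 3 * γ * ((n : ℝ) + 1) by positivity])
            simp only [hx0, hy0]
            linarith) ht₁ hneg.le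
      have hge : ∀ t, 0 ≤ t → 0 ≤ x t := by
        intro t ht
        by_contra! hlt
        rcases ht.lt_or_eq with ht | rfl
        · exact absurd (h.fst_neg_of_lt P hlt.le ht) (by rw [hx0]; exact lt_irrefl 0)
        · exact absurd hx0 hlt.ne
      have hle : ∀ t ∈ Set.Icc 0 T, x t ≤ c := fun t ht =>
        le_of_deriv_neg_at_level (h.hasDerivAt_fst_fluid P) ht.1 (hx0.trans_le hc0.le)
          fun u hu hxu => by
            rw [InteriorSolution.deriv_fst_at_center P hxu]
            have h1 := hTpos u ⟨hu.1, hu.2.le.trans ht.2⟩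
            simp only [hxu] at h1
            exact mul_neg_of_pos_of_neg (by positivity) (by linarith)
      -- The log ratio falls at rate at most 2ac = 3γ and must fall by 3γ(n + 1).
      have hlong : (n : ℝ) ≤ T := by
        have h1 := mul_sub_le_sub_of_le_deriv (h.hasDerivAt_log_ratio P) (ε := -(3 * γ)) hT0
          fun u hu => by linarith [P.two_mul, mul_nonneg ha.le (hge u hu.1)]
        rw [hw0, h.log_ratio_of_section (sub_eq_zero.1 hTsec)] at h1
        have : 3 * γ * (n + 1) ≤ 3 * γ * T := by linarith
        have := le_of_mul_le_mul_left this (by positivity)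
        linarith
      refine ⟨_, _, h.shift T, fun t ht => ⟨hge _ (by linarith [ht.1]),
        hle _ ⟨by linarith [ht.1], by linarith [ht.2]⟩⟩, ?_⟩
      simpa using sub_eq_zero.1 hTsec
  refine ⟨x, y, h, h.tendsto_FL P ⟨0, fun heq => ?_⟩ (fun t ht => (hconf t ht).1)
    fun t ht => (hconf t ht).2⟩
  rw [Prod.mk.injEq] at heq
  rw [heq.1, heq.2] at hsec
  exact hs.ne hsec

/-- The mirror image of the construction at FL: the start is on x = a/3 ever closer to P, the
section lies below S, and c ≤ x ≤ a/3 bounds the growth rate of the log ratio by 2a(a/3 - c). -/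
theorem exists_tendsto_powerLaw (P : Parameters γ a c) (ha3 : a < 3) :
    ∃ x y, InteriorSolution γ a x y ∧ Tendsto (fun t => (x t, y t)) atBot (𝓝 (a / 3, 0)) := by
  obtain ⟨wS, hwS⟩ := P.exists_sigmoid
  have hc1 := P.c_sq_lt_one
  have hc0 := P.c_pos
  have ha := P.a_pos
  have hca : c < a / 3 := by linarith [P.three_mul_lt]
  have hν : 0 < 2 * a * (a / 3 - c) := mul_pos (by positivity) (by linarith)
  have hs : Real.sigmoid (wS - 1) * (1 - c ^ 2) < 1 - 3 * c / a := by
    rw [← hwS]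
    exact mul_lt_mul_of_pos_right (Real.sigmoid_lt (sub_one_lt wS)) hc1
  have hp : 0 < 1 - (a / 3) ^ 2 := by nlinarith
  obtain ⟨x, y, h, hconf, hsec⟩ := exists_confined_in_past (γ := γ) (a := a) (l := c)
    (u := a / 3) (s := Real.sigmoid (wS - 1)) (by linarith) (by linarith) (Real.sigmoid_pos _)
    (Real.sigmoid_lt_one _) fun n => by
      obtain ⟨x, y, h, hx0, hy0, hw0⟩ := exists_interiorSolution_of_log_ratio γ a hp
        (wS - 1 - 2 * a * (a / 3 - c) * (n + 1))
      obtain ⟨t₁, ht₁, hneg⟩ := ((eventually_ge_atTop 0).and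
        ((tendsto_order.1 (h.tendsto_section P (Real.sigmoid (wS - 1)))).1 0
          (by linarith))).exists
      obtain ⟨T, hT0, hTsec, hTpos⟩ := exists_first_zero
        (f := fun t => -(y t - Real.sigmoid (wS - 1) * (1 - x t ^ 2)))
        (h.continuous_snd.sub (continuous_const.mul (continuous_const.sub
          (h.continuous_fst.pow 2)))).neg (by
            have : Real.sigmoid (wS - 1 - 2 * a * (a / 3 - c) * (n + 1))
                < Real.sigmoid (wS - 1) := Real.sigmoid_lt
              (by linarith [show 0 < 2 * a * (a / 3 - c) * ((n : ℝ) + 1) by positivity])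
            simp only [hx0, hy0]
            linarith [mul_lt_mul_of_pos_right this hp]) ht₁ (neg_nonpos.2 hneg.le)
      have hle : ∀ t, 0 ≤ t → x t ≤ a / 3 := by
        intro t ht
        by_contra! hlt
        rcases ht.lt_or_eq with ht | rfl
        · exact absurd (h.third_lt_fst_of_lt P hlt.le ht) (by rw [hx0]; exact lt_irrefl _)
        · exact absurd hx0 hlt.ne'
      have hge : ∀ t ∈ Set.Icc 0 T, c ≤ x t := fun t ht =>
        ge_of_deriv_pos_at_level (h.hasDerivAt_fst_fluid P) ht.1 (hca.le.trans_eq hx0.symm)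
          fun u hu hxu => by
            rw [InteriorSolution.deriv_fst_at_center P hxu]
            have h1 := hTpos u ⟨hu.1, hu.2.le.trans ht.2⟩
            simp only [hxu] at h1
            exact mul_pos (by positivity) (by linarith)
      have hTsec' : y T = Real.sigmoid (wS - 1) * (1 - x T ^ 2) := by linarith
      have hlong : (n : ℝ) ≤ T := by
        have h1 := mul_sub_le_sub_of_le_deriv (fun u => (h.hasDerivAt_log_ratio P u).neg)
          (ε := -(2 * a * (a / 3 - c))) hT0
          fun u hu => neg_le_neg (mul_le_mul_of_nonneg_left (by linarith [hle u hu.1])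
            (by positivity))
        simp only [Pi.neg_apply] at h1
        rw [hw0, h.log_ratio_of_section hTsec'] at h1
        have : 2 * a * (a / 3 - c) * (n + 1) ≤ 2 * a * (a / 3 - c) * T := by linarith
        have := le_of_mul_le_mul_left this hν
        linarith
      refine ⟨_, _, h.shift T, fun t ht => ⟨hge _ ⟨by linarith [ht.1], by linarith [ht.2]⟩,
        hle _ (by linarith [ht.1])⟩, ?_⟩
      simpa using hTsec'
  refine ⟨x, y, h, h.tendsto_powerLaw P ha3 ⟨0, fun heq => ?_⟩ (fun t ht => (hconf t ht).1)
    fun t ht => (hconf t ht).2⟩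
  rw [Prod.mk.injEq] at heq
  rw [heq.1, heq.2] at hsec
  exact hs.ne hsec.symm

end ScalarFluid

namespace ScalarFluid

variable {γ a c : ℝ}

/-! ### Uniqueness of solutions from the saddle points -/

theorem quadratic_form_nonpos {A B C u v : ℝ} (hA : A < 0) (hdisc : B ^ 2 ≤ 4 * A * C) :
    A * u ^ 2 + B * (u * v) + C * v ^ 2 ≤ 0 := by
  by_contra! hpos
  have h1 := mul_neg_of_neg_of_pos hA hpos
  nlinarith [sq_nonneg (2 * A * u + B * v), mul_nonneg (sub_nonneg.2 hdisc) (sq_nonneg v)]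

/-- Near a saddle point on the boundary, two solutions coming from the saddle that agree in
`Ω_pf` agree in `Σ_φ`. -/
theorem exists_nhds_fst_eq_of_snd_eq (γ a : ℝ) {ξ η : ℝ} (hξη : ξ * η = 0)
    (hstable : -3 + 9 * ξ ^ 2 + 3 / 2 * γ * η - 2 * a * ξ < 0)
    (hunstable : 0 < 6 * ξ ^ 2 + 6 * γ * η - 3 * γ) :
    ∃ U ∈ 𝓝 (ξ, η), ∀ x y x' y' : ℝ → ℝ, InteriorSolution γ a x y → InteriorSolution γ a x' y' →
      Tendsto (fun t => (x t, y t)) atBot (𝓝 (ξ, η)) →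
      Tendsto (fun t => (x' t, y' t)) atBot (𝓝 (ξ, η)) →
      ∀ T : ℝ, (∀ t ≤ T, (x t, y t) ∈ U) → (∀ t ≤ T, (x' t, y' t) ∈ U) →
      y T = y' T → x T = x' T := by
  set μ := -(-3 + 9 * ξ ^ 2 + 3 / 2 * γ * η - 2 * a * ξ)
  set ν := 6 * ξ ^ 2 + 6 * γ * η - 3 * γ
  set b := 3 / 2 * γ * ξ - a
  have hμ : 0 < μ := neg_pos.2 hstable
  -- At the saddle the linearization has diagonal -μ, ν and upper right entry b. This K gives b² <
  -- 4Kμν, so (Δx)² - K(Δy)² has a negative definite derivative there.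
  set K := b ^ 2 / (μ * ν) + 1
  have hK : 0 < K := by positivity
  have hKμν : K * (μ * ν) = b ^ 2 + μ * ν := by
    simp only [K]
    field_simp
  -- Divided differences: the matrix (mᵢⱼ) maps the difference of two states exactly to the
  -- difference of the fields. Its entries are continuous, so the definiteness persists near the
  -- saddle.
  let m₁₁ : (ℝ × ℝ) × (ℝ × ℝ) → ℝ := fun z =>
    -3 + 3 * (z.1.1 ^ 2 + z.1.1 * z.2.1 + z.2.1 ^ 2) + 3 / 2 * γ * z.1.2 - a * (z.1.1 + z.2.1)
  let m₁₂ : (ℝ × ℝ) × (ℝ × ℝ) → ℝ := fun z => 3 / 2 * γ * z.2.1 - a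
  let m₂₁ : (ℝ × ℝ) × (ℝ × ℝ) → ℝ := fun z => 6 * (z.1.1 + z.2.1) * z.1.2
  let m₂₂ : (ℝ × ℝ) × (ℝ × ℝ) → ℝ := fun z => 6 * z.2.1 ^ 2 + 3 * γ * (z.1.2 + z.2.2) - 3 * γ
  have hopen₁ : ∀ᶠ z in 𝓝 ((ξ, η), (ξ, η)), m₁₁ z < 0 := by
    refine ContinuousAt.eventually_lt (by fun_prop) continuousAt_const ?_
    simp only [m₁₁]
    linarith
  have hopen₂ : ∀ᶠ z in 𝓝 ((ξ, η), (ξ, η)),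
      (m₁₂ z - K * m₂₁ z) ^ 2 < 4 * m₁₁ z * (-(K * m₂₂ z)) := by
    refine ContinuousAt.eventually_lt (by fun_prop) (by fun_prop) ?_
    have e1 : m₁₁ ((ξ, η), (ξ, η)) = -μ := by simp only [m₁₁, μ]; ring
    have e2 : m₁₂ ((ξ, η), (ξ, η)) = b := rfl
    have e3 : m₂₁ ((ξ, η), (ξ, η)) = 0 := by
      simp only [m₂₁]
      linear_combination 12 * hξη
    have e4 : m₂₂ ((ξ, η), (ξ, η)) = ν := by simp only [m₂₂, ν]; ring
    rw [e1, e2, e3, e4]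
    nlinarith [mul_pos hμ hunstable, sq_nonneg b]
  have hev := hopen₁.and hopen₂
  rw [nhds_prod_eq, eventually_prod_self_iff'] at hev
  obtain ⟨U, hU, hgood⟩ := hev
  refine ⟨U, hU, fun x y x' y' h h' hl hl' T hT hT' hyy => ?_⟩
  -- E decreases in time and tends to 0 at -∞, so E ≤ 0; where the y-values agree this forces the
  -- x-values to agree.
  let E : ℝ → ℝ := fun t => (x t - x' t) ^ 2 - K * (y t - y' t) ^ 2
  have hE : ∀ t, HasDerivAt E (2 * (m₁₁ ((x t, y t), (x' t, y' t)) * (x t - x' t) ^ 2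
      + (m₁₂ ((x t, y t), (x' t, y' t)) - K * m₂₁ ((x t, y t), (x' t, y' t)))
        * ((x t - x' t) * (y t - y' t))
      + -(K * m₂₂ ((x t, y t), (x' t, y' t))) * (y t - y' t) ^ 2)) t := by
    intro t
    refine ((((h.deriv_fst t).sub (h'.deriv_fst t)).pow 2).sub
      ((((h.deriv_snd t).sub (h'.deriv_snd t)).pow 2).const_mul K)).congr_deriv ?_
    simp only [m₁₁, m₁₂, m₂₁, m₂₂, Nat.cast_ofNat, Pi.sub_apply]
    ring
  have hmono : ∀ t ≤ T, E T ≤ E t := by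
    intro t ht
    have := mul_sub_le_sub_of_le_deriv (fun u => (hE u).neg) (ε := 0) ht fun u hu => by
      obtain ⟨h1, h2⟩ := hgood _ (hT u hu.2) _ (hT' u hu.2)
      linarith [quadratic_form_nonpos (u := x u - x' u) (v := y u - y' u) h1 h2.le]
    simp only [Pi.neg_apply] at this
    linarith
  have hlim : Tendsto E atBot (𝓝 0) := by
    rw [nhds_prod_eq] at hl hl'
    simpa using ((hl.fst.sub hl'.fst).pow 2).sub (((hl.snd.sub hl'.snd).pow 2).const_mul K)
  have hET : E T ≤ 0 := ge_of_tendsto hlim ((eventually_le_atBot T).mono hmono)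
  simp only [E, hyy, sub_self, ne_eq, OfNat.ofNat_ne_zero, not_false_eq_true, zero_pow, mul_zero,
    sub_zero] at hET
  exact sub_eq_zero.1 (pow_eq_zero_iff two_ne_zero |>.1 (le_antisymm hET (sq_nonneg _)))

theorem exists_eq_of_tendsto_zero_atBot {f : ℝ → ℝ} (hf : Continuous f)
    (hlim : Tendsto f atBot (𝓝 0)) {T d : ℝ} (hd : 0 < d) (hdT : d ≤ f T) :
    ∃ t ≤ T, f t = d := by
  obtain ⟨s, hs, hsT⟩ := (((tendsto_order.1 hlim).2 d hd).and (eventually_le_atBot T)).exists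
  obtain ⟨t, ht, rfl⟩ := intermediate_value_Icc hsT hf.continuousOn ⟨hs.le, hdT⟩
  exact ⟨t, ht.2, rfl⟩

/-- Two solutions coming from the same boundary saddle run through a common point; `σ = ±1` says
on which side of the saddle they lie. -/
theorem exists_common_point_of_tendsto_saddle {ξ η σ : ℝ} (hξη : ξ * η = 0)
    (hstable : -3 + 9 * ξ ^ 2 + 3 / 2 * γ * η - 2 * a * ξ < 0)
    (hunstable : 0 < 6 * ξ ^ 2 + 6 * γ * η - 3 * γ) {x y x' y' : ℝ → ℝ}
    (h : InteriorSolution γ a x y) (h' : InteriorSolution γ a x' y')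
    (hl : Tendsto (fun t => (x t, y t)) atBot (𝓝 (ξ, η)))
    (hl' : Tendsto (fun t => (x' t, y' t)) atBot (𝓝 (ξ, η)))
    (hside : ∀ t, 0 < σ * (y t - η)) (hside' : ∀ t, 0 < σ * (y' t - η)) :
    ∃ t t', x t = x' t' ∧ y t = y' t' := by
  obtain ⟨U, hU, huniq⟩ := exists_nhds_fst_eq_of_snd_eq γ a hξη hstable hunstable
  obtain ⟨T, hT⟩ := eventually_atBot.1 (hl.eventually_mem hU)
  obtain ⟨T', hT'⟩ := eventually_atBot.1 (hl'.eventually_mem hU)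
  have hlim : ∀ {x y : ℝ → ℝ}, Tendsto (fun t => (x t, y t)) atBot (𝓝 (ξ, η)) →
      Tendsto (fun t => σ * (y t - η)) atBot (𝓝 0) := by
    intro x y hl
    rw [nhds_prod_eq] at hl
    simpa using (hl.snd.sub_const η).const_mul σ
  -- Both solutions lie on the same side of the level y = η and tend to it, so both take a common
  -- value of y early enough; a time shift makes these instants coincide.
  have hd : 0 < min (σ * (y T - η)) (σ * (y' T' - η)) := lt_min (hside T) (hside' T')
  obtain ⟨t, ht, hyt⟩ := exists_eq_of_tendsto_zero_atBot (f := fun t => σ * (y t - η))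
    (continuous_const.mul (h.continuous_snd.sub continuous_const)) (hlim hl) hd (min_le_left _ _)
  obtain ⟨t', ht', hyt'⟩ := exists_eq_of_tendsto_zero_atBot (f := fun t => σ * (y' t - η))
    (continuous_const.mul (h'.continuous_snd.sub continuous_const)) (hlim hl') hd
    (min_le_right _ _)
  have hσ : σ ≠ 0 := by
    rintro rfl
    simpa using hside 0
  have hyy : y t = y' t' := by
    have := mul_left_cancel₀ hσ (hyt.trans hyt'.symm)
    linarith
  refine ⟨t, t', ?_, hyy⟩
  have hshift : t + (t' - t) = t' := by ring
  have := huniq x y (fun s => x' (s + (t' - t))) (fun s => y' (s + (t' - t))) h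
    (h'.shift (t' - t)) hl
    (hl'.comp (tendsto_atBot_add_const_right _ (t' - t) tendsto_id)) t
    (fun s hs => hT s (hs.trans ht)) (fun s hs => hT' _ (by linarith)) (by rw [hshift, hyy])
  rwa [hshift] at this

end ScalarFluid

namespace ScalarFluid

/-! ### Orbits -/

variable {γ lam : ℝ} {x y : ℝ → ℝ}

theorem parameters_of_lt (hγ₀ : 0 < γ) (hγ₂ : γ < 2) (hlam : 0 ≤ lam) (h : γ < lam ^ 2 / 3) :
    Parameters γ (√(3 / 2) * lam) (√(3 / 2) * (γ / lam)) := by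
  have hl : 0 < lam := hlam.lt_of_ne (by rintro rfl; norm_num at h; linarith)
  have hs : 0 < √(3 / 2 : ℝ) := by positivity
  have hsq : √(3 / 2 : ℝ) * √(3 / 2) = 3 / 2 := Real.mul_self_sqrt (by norm_num)
  refine ⟨hγ₀, hγ₂, by positivity, ?_, ?_⟩
  · have : lam * (γ / lam) = γ := by field_simp
    linear_combination 2 * γ * hsq + 2 * √(3 / 2) * √(3 / 2) * this
  · have : 3 * (γ / lam) < lam := by
      rw [mul_div_assoc', div_lt_iff₀ hl]
      linarith
    linarith [mul_lt_mul_of_pos_left this hs]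

theorem S_eq (hlam : lam ≠ 0) :
    S γ lam = (√(3 / 2) * (γ / lam), 1 - 3 * (√(3 / 2) * (γ / lam)) / (√(3 / 2) * lam)) := by
  have hs : √(3 / 2 : ℝ) ≠ 0 := by positivity
  simp only [S, Prod.mk.injEq, true_and]
  field_simp

theorem third_eq (lam : ℝ) : √(3 / 2) * lam / 3 = lam / √6 := by
  have h6 : √(3 / 2 : ℝ) * √6 = 3 := by
    rw [← Real.sqrt_mul (by norm_num), show (3 / 2 : ℝ) * 6 = 3 ^ 2 by norm_num,
      Real.sqrt_sq (by norm_num)]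
  have : √6 ≠ (0 : ℝ) := by positivity
  rw [div_eq_div_iff (by norm_num) this]
  linear_combination lam * h6

theorem lt_sqrt_six_iff : √(3 / 2) * lam < 3 ↔ lam < √6 := by
  have := third_eq lam
  rw [← div_lt_one (by norm_num : (0 : ℝ) < 3), this, div_lt_one (by positivity)]

theorem IsSolution.interiorSolution {p : ℝ → ℝ × ℝ} (hp : IsSolution γ lam p)
    (hmem_int : Set.range p ⊆ interiorStates) :
    InteriorSolution γ (√(3 / 2) * lam) (fun t => (p t).1) (fun t => (p t).2) := by
  have hp' : ∀ t, HasDerivAt p (rhs γ (√(3 / 2) * lam) (p t)) t := fun t => by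
    rw [← field_eq_rhs]
    exact hp t
  exact
    { deriv_fst := fun t => (hasFDerivAt_fst (𝕜 := ℝ) (p := p t)).comp_hasDerivAt t (hp' t)
      deriv_snd := fun t => (hasFDerivAt_snd (𝕜 := ℝ) (p := p t)).comp_hasDerivAt t (hp' t)
      pos := fun t => (hmem_int ⟨t, rfl⟩).2
      lt := fun t => (hmem_int ⟨t, rfl⟩).1 }

theorem InteriorSolution.isSolution (h : InteriorSolution γ (√(3 / 2) * lam) x y) :
    IsSolution γ lam fun t => (x t, y t) := fun t => by
  rw [field_eq_rhs]
  exact h.hasDerivAt_prod t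

theorem InteriorSolution.range_subset {a : ℝ} (h : InteriorSolution γ a x y) :
    Set.range (fun t => (x t, y t)) ⊆ interiorStates := by
  rintro _ ⟨t, rfl⟩
  exact ⟨h.lt t, h.pos t⟩

theorem isInteriorOrbit_iff {O : Set (ℝ × ℝ)} : IsInteriorOrbit γ lam O ↔
    ∃ x y, InteriorSolution γ (√(3 / 2) * lam) x y ∧ Set.range (fun t => (x t, y t)) = O := by
  constructor
  · rintro ⟨p, hp, rfl, hmem_int⟩
    exact ⟨_, _, hp.interiorSolution hmem_int, rfl⟩
  · rintro ⟨x, y, h, rfl⟩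
    exact ⟨_, h.isSolution, rfl, h.range_subset⟩

theorem mem_interiorOrbitsFrom_iff {O : Set (ℝ × ℝ)} {q : ℝ × ℝ} :
    O ∈ interiorOrbitsFrom γ lam q ↔ ∃ x y, InteriorSolution γ (√(3 / 2) * lam) x y ∧
      Set.range (fun t => (x t, y t)) = O ∧ Tendsto (fun t => (x t, y t)) atBot (𝓝 q) := by
  constructor
  · rintro ⟨⟨-, -, -, hmem_int⟩, p, hp, rfl, hlim⟩
    exact ⟨_, _, hp.interiorSolution hmem_int, rfl, hlim⟩
  · rintro ⟨x, y, h, rfl, hlim⟩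
    exact ⟨⟨_, h.isSolution, rfl, h.range_subset⟩, _, h.isSolution, rfl, hlim⟩

theorem InteriorSolution.range_eq_of_common_point {a : ℝ} {x' y' : ℝ → ℝ}
    (h : InteriorSolution γ a x y) (h' : InteriorSolution γ a x' y') {t t' : ℝ}
    (hx : x t = x' t') (hy : y t = y' t') :
    Set.range (fun t => (x t, y t)) = Set.range fun t => (x' t, y' t) := by
  have hshift : t + (t' - t) = t' := by ring
  obtain ⟨rfl, rfl⟩ := h.eq_of_eq_at (h'.shift (t' - t)) (t₀ := t) (by rw [hshift, hx])
    (by rw [hshift, hy])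
  exact (Equiv.addRight (t' - t)).surjective.range_comp fun t => (x' t, y' t)

theorem existsUnique_interiorOrbit {p : ℝ × ℝ} (hp : p ∈ interiorStates) :
    ∃! O : Set (ℝ × ℝ), IsInteriorOrbit γ lam O ∧ p ∈ O := by
  obtain ⟨x, y, h, hx, hy⟩ := exists_interiorSolution γ (√(3 / 2) * lam) hp.2 hp.1
  refine ⟨_, ⟨isInteriorOrbit_iff.2 ⟨x, y, h, rfl⟩, 0, by simp [hx, hy]⟩, ?_⟩
  rintro O ⟨hO, hpO⟩
  obtain ⟨x', y', h', rfl⟩ := isInteriorOrbit_iff.1 hO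
  obtain ⟨t, rfl⟩ := hpO
  exact h'.range_eq_of_common_point h hx.symm hy.symm

theorem existsUnique_interiorOrbit_from_saddle {ξ η σ : ℝ} (hξη : ξ * η = 0)
    (hstable : -3 + 9 * ξ ^ 2 + 3 / 2 * γ * η - 2 * (√(3 / 2) * lam) * ξ < 0)
    (hunstable : 0 < 6 * ξ ^ 2 + 6 * γ * η - 3 * γ)
    (hside : ∀ x y : ℝ → ℝ, InteriorSolution γ (√(3 / 2) * lam) x y → ∀ t, 0 < σ * (y t - η))
    (hex : ∃ x y, InteriorSolution γ (√(3 / 2) * lam) x y ∧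
      Tendsto (fun t => (x t, y t)) atBot (𝓝 (ξ, η))) :
    ∃! O : Set (ℝ × ℝ), O ∈ interiorOrbitsFrom γ lam (ξ, η) := by
  obtain ⟨x, y, h, hlim⟩ := hex
  refine ⟨_, mem_interiorOrbitsFrom_iff.2 ⟨x, y, h, rfl, hlim⟩, fun O hO => ?_⟩
  obtain ⟨x', y', h', rfl, hlim'⟩ := mem_interiorOrbitsFrom_iff.1 hO
  obtain ⟨t, t', hx, hy⟩ := exists_common_point_of_tendsto_saddle hξη hstable hunstable h' h
    hlim' hlim (hside _ _ h') (hside _ _ h)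
  exact h'.range_eq_of_common_point h hx hy

/-- If the line `Σ_φ = ξ` is a section for the interior orbits from `q`, then these orbits form a
1-parameter set. -/
theorem isOneParameterSet_of_section {ξ : ℝ} {q : ℝ × ℝ} (hξ : 0 < 1 - ξ ^ 2)
    (hfrom : ∀ x y : ℝ → ℝ, InteriorSolution γ (√(3 / 2) * lam) x y → ∀ t, x t = ξ →
      Tendsto (fun t => (x t, y t)) atBot (𝓝 q))
    (hcross : ∀ x y : ℝ → ℝ, InteriorSolution γ (√(3 / 2) * lam) x y →
      Tendsto (fun t => (x t, y t)) atBot (𝓝 q) → ∃! t, x t = ξ) :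
    IsOneParameterSet (interiorOrbitsFrom γ lam q) := by
  refine ⟨fun s => (ξ, Real.sigmoid s * (1 - ξ ^ 2)),
    continuous_const.prodMk (continuous_sigmoid.mul continuous_const), fun s => ?_,
    fun O hO => ?_⟩
  · obtain ⟨x, y, h, hx, hy, -⟩ :=
      exists_interiorSolution_of_log_ratio γ (√(3 / 2) * lam) hξ s
    exact ⟨_, mem_interiorOrbitsFrom_iff.2 ⟨x, y, h, rfl, hfrom x y h 0 hx⟩, 0, by
      simp only [hx, hy]⟩
  · obtain ⟨x, y, h, rfl, hlim⟩ := mem_interiorOrbitsFrom_iff.1 hO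
    obtain ⟨t, ht, huniq⟩ := hcross x y h hlim
    have hmem : y t / (1 - ξ ^ 2) ∈ Set.Ioo (0 : ℝ) 1 := by
      refine ⟨div_pos (h.pos t) hξ, (div_lt_one hξ).2 ?_⟩
      have := h.lt t
      rw [ht] at this
      linarith
    rw [← Real.range_sigmoid] at hmem
    obtain ⟨s, hs⟩ := hmem
    have hys : y t = Real.sigmoid s * (1 - ξ ^ 2) := by rw [hs, div_mul_cancel₀ _ hξ.ne']
    refine ⟨s, ⟨t, by simp only [ht, hys]⟩, ?_⟩
    rintro s' ⟨t', ht'⟩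
    simp only [Prod.mk.injEq] at ht'
    rw [huniq t' ht'.1, hys] at ht'
    exact (Real.sigmoid_injective (mul_right_cancel₀ hξ.ne' ht'.2)).symm

/-! ### The orbits from each fixed point -/

variable {c : ℝ}

theorem isOneParameterSet_Kminus (P : Parameters γ (√(3 / 2) * lam) c) :
    IsOneParameterSet (interiorOrbitsFrom γ lam Kminus) := by
  refine isOneParameterSet_of_section (ξ := 0) (by norm_num)
    (fun x y h t ht => h.tendsto_Kminus P ht.le) fun x y h hlim => ?_
  have hlim' := h.tendsto_scaling P
  rw [Kminus, nhds_prod_eq] at hlim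
  rw [nhds_prod_eq] at hlim'
  obtain ⟨s, hs⟩ := ((tendsto_order.1 hlim.fst).2 0 (by norm_num)).exists
  obtain ⟨s', hs'⟩ := ((tendsto_order.1 hlim'.fst).1 0 P.c_pos).exists
  obtain ⟨t, ht⟩ := mem_range_of_exists_le_of_exists_ge h.continuous_fst ⟨s, hs.le⟩ ⟨s', hs'.le⟩
  refine ⟨t, ht, fun t' ht' => ?_⟩
  by_contra hne
  rcases lt_or_gt_of_ne hne with hlt | hlt
  · exact (h.fst_neg_of_lt P ht.le hlt).ne ht'
  · exact (h.fst_neg_of_lt P (le_of_eq ht') hlt).ne ht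

theorem isOneParameterSet_Kplus (P : Parameters γ (√(3 / 2) * lam) c)
    (ha : √(3 / 2) * lam < 3) : IsOneParameterSet (interiorOrbitsFrom γ lam Kplus) := by
  have ha0 := P.a_pos
  refine isOneParameterSet_of_section (ξ := √(3 / 2) * lam / 3) (by nlinarith)
    (fun x y h t ht => h.tendsto_Kplus P ht.ge) fun x y h hlim => ?_
  have hlim' := h.tendsto_scaling P
  rw [Kplus, nhds_prod_eq] at hlim
  rw [nhds_prod_eq] at hlim'
  obtain ⟨s, hs⟩ := ((tendsto_order.1 hlim.fst).1 (√(3 / 2) * lam / 3) (by linarith)).exists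
  obtain ⟨s', hs'⟩ := ((tendsto_order.1 hlim'.fst).2 (√(3 / 2) * lam / 3)
    (by linarith [P.three_mul_lt])).exists
  obtain ⟨t, ht⟩ := mem_range_of_exists_le_of_exists_ge h.continuous_fst ⟨s', hs'.le⟩ ⟨s, hs.le⟩
  refine ⟨t, ht, fun t' ht' => ?_⟩
  by_contra hne
  rcases lt_or_gt_of_ne hne with hlt | hlt
  · exact (h.third_lt_fst_of_lt P ht.ge hlt).ne' ht'
  · exact (h.third_lt_fst_of_lt P (ge_of_eq ht') hlt).ne' ht

theorem existsUnique_interiorOrbit_from_FL (P : Parameters γ (√(3 / 2) * lam) c) :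
    ∃! O : Set (ℝ × ℝ), O ∈ interiorOrbitsFrom γ lam FL :=
  existsUnique_interiorOrbit_from_saddle (σ := -1) (by norm_num) (by linarith [P.γ_lt_two])
    (by linarith [P.γ_pos]) (fun x y h t => by linarith [h.snd_lt_one t]) (exists_tendsto_FL P)

theorem existsUnique_interiorOrbit_from_P (P : Parameters γ (√(3 / 2) * lam) c)
    (ha : √(3 / 2) * lam < 3) :
    ∃! O : Set (ℝ × ℝ), O ∈ interiorOrbitsFrom γ lam (ScalarFluid.P lam) := by
  rw [ScalarFluid.P, ← third_eq]
  have ha0 := P.a_pos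
  refine existsUnique_interiorOrbit_from_saddle (σ := 1) (by norm_num) (by nlinarith) ?_
    (fun x y h t => by linarith [h.pos t]) (exists_tendsto_powerLaw P ha)
  nlinarith [P.two_mul, mul_pos ha0 (sub_pos.2 P.three_mul_lt)]

theorem mem_interiorOrbitsFrom_Kminus (P : Parameters γ (√(3 / 2) * lam) c)
    (ha : 3 ≤ √(3 / 2) * lam) {O : Set (ℝ × ℝ)} (hO : IsInteriorOrbit γ lam O)
    (hS : O ≠ {(c, 1 - 3 * c / (√(3 / 2) * lam))}) (hFL : O ∉ interiorOrbitsFrom γ lam FL) :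
    O ∈ interiorOrbitsFrom γ lam Kminus := by
  obtain ⟨x, y, h, rfl⟩ := isInteriorOrbit_iff.1 hO
  by_cases hx : ∃ t, x t ≤ 0
  · obtain ⟨t, ht⟩ := hx
    exact mem_interiorOrbitsFrom_iff.2 ⟨x, y, h, rfl, h.tendsto_Kminus P ht⟩
  push Not at hx
  -- With x > 0 throughout, only the stationary orbit and the one from FL are possible, and both are
  -- excluded by hypothesis.
  have hns : ∃ t, (x t, y t) ≠ (c, 1 - 3 * c / (√(3 / 2) * lam)) := by
    by_contra! hall
    exact hS (by rw [funext hall, Set.range_const])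
  exact absurd (mem_interiorOrbitsFrom_iff.2
    ⟨x, y, h, rfl, h.tendsto_FL_of_three_le P ha hns hx⟩) hFL

end ScalarFluid

/-- Global interior dynamics for `γ < λ²/3`. The first conjunct records that the interior is
partitioned into complete interior orbits; in the last one the stationary orbit `{S}` is excepted. -/
theorem theorem2 (γ lam : ℝ) (hγ₀ : 0 < γ) (hγ₂ : γ < 2) (hlam : 0 ≤ lam)
    (h : γ < lam ^ 2 / 3) :
    (∀ p ∈ ScalarFluid.interiorStates,
      ∃! O : Set (ℝ × ℝ), ScalarFluid.IsInteriorOrbit γ lam O ∧ p ∈ O) ∧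
    (∀ O : Set (ℝ × ℝ), ScalarFluid.IsInteriorOrbit γ lam O →
      ScalarFluid.EndsAt γ lam O (ScalarFluid.S γ lam)) ∧
    (∃! O : Set (ℝ × ℝ), O ∈ ScalarFluid.interiorOrbitsFrom γ lam ScalarFluid.FL) ∧
    ScalarFluid.IsOneParameterSet (ScalarFluid.interiorOrbitsFrom γ lam ScalarFluid.Kminus) ∧
    (lam < √6 →
      ScalarFluid.IsOneParameterSet (ScalarFluid.interiorOrbitsFrom γ lam ScalarFluid.Kplus) ∧
      ∃! O : Set (ℝ × ℝ),
        O ∈ ScalarFluid.interiorOrbitsFrom γ lam (ScalarFluid.P lam)) ∧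
    (√6 ≤ lam → ∀ O : Set (ℝ × ℝ), ScalarFluid.IsInteriorOrbit γ lam O →
      O ≠ {ScalarFluid.S γ lam} →
      O ∉ ScalarFluid.interiorOrbitsFrom γ lam ScalarFluid.FL →
      O ∈ ScalarFluid.interiorOrbitsFrom γ lam ScalarFluid.Kminus) := by
  have P := ScalarFluid.parameters_of_lt hγ₀ hγ₂ hlam h
  have hl : lam ≠ 0 := by
    rintro rfl
    norm_num at h
    linarith
  refine ⟨fun p hp => ScalarFluid.existsUnique_interiorOrbit hp, fun O hO => ?_,
    ScalarFluid.existsUnique_interiorOrbit_from_FL P, ScalarFluid.isOneParameterSet_Kminus P,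
    fun hlt => ?_, fun hle O hO hS hFL => ?_⟩
  · obtain ⟨x, y, hsol, rfl⟩ := ScalarFluid.isInteriorOrbit_iff.1 hO
    rw [ScalarFluid.S_eq hl]
    exact ⟨_, hsol.isSolution, rfl, hsol.tendsto_scaling P⟩
  · have ha := ScalarFluid.lt_sqrt_six_iff.2 hlt
    exact ⟨ScalarFluid.isOneParameterSet_Kplus P ha,
      ScalarFluid.existsUnique_interiorOrbit_from_P P ha⟩
  · rw [ScalarFluid.S_eq hl] at hS
    exact ScalarFluid.mem_interiorOrbitsFrom_Kminus P
      (not_lt.1 fun hlt => not_lt.2 hle (ScalarFluid.lt_sqrt_six_iff.1 hlt)) hO hS hFL
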